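/- **Setting.** Graphs are finite and directed, $G=(V,E)$ with $E\subseteq V\times V$; $G(-,v)$ denotes the set of parents of $v$. A homomorphism $\varphi:G\to H$ maps edges to edges; it is a fibration if moreover $\varphi|_{G(-,v)}:G(-,v)\to H(-,\varphi(v))$ is bijective for every vertex $v$ of $G$. Let $B=(V_B,E_B)$ be a finite directed acyclic graph and $\mathbb B=((I_B,T_B),(\mathcal Y,\mathcal Z,\mathcal W),(M,\sigma))$ a perceptron module over $B$: $I_B,T_B\subseteq V_B$, the vertices of $I_B$ have no parents, $\mathcal Y_b$ ($b\in V_B$), $\mathcal Z_e$ and $\mathcal W_e$ ($e\in E_B$) are finite-dimensional Euclidean spaces, $M_{(a,b)}:\mathcal W_{(a,b)}\times\mathcal Y_a\to\mathcal Z_{(a,b)}$ and $\sigma_b:\prod_{a\in B(-,b)}\mathcal Z_{(a,b)}\to\mathcal Y_b$ for $b\notin I_B$. Let $n^0:I_B\to\mathbb N$ and $\mathcal C=\coprod_{b\in I_B}[n^0_b]$, with projection $p_{\mathcal C}:\mathcal C\to I_B$. A lift is a triple $(G,\pi,c)$ with $\pi:G\to B$ a graph homomorphism and $c:\pi^{-1}(I_B)\to\mathcal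 C$ injective with $p_{\mathcal C}\circ c=\pi$; its parameters are the elements $w$ of $\prod_{e\in E_G}\mathcal W_{\pi(e)}$, with $\|w\|^2=\sum_e\|w_e\|^2$. *Covers.* A morphism of lifts $(G,\pi_G,c_G)\to(H,\pi_H,c_H)$ is a fibration $\varphi:G\to H$ with $\pi_H\circ\varphi=\pi_G$ and $c_H\circ\varphi=c_G$. For lifts with parameters $(G,w_G)$, $(H,w_H)$, a function $\alpha:V_H\to\mathbb R$ and $\eta>0$, we say that $(G,w_G)$ has an $(\alpha,\eta)$-cover of $(H,w_H)$ if there are a subgraph $S$ of $G$ whose inclusion in $G$ is a morphism of lifts (for the restrictions of $\pi_G,c_G$ to $S$) and a morphism of lifts $\varphi:S\to H$ such that $\|(w_G)_e-(w_H)_{\varphi(e)}\|\le\eta$ for every edge $e$ of $S$ and $\#\varphi^{-1}(v)\ge\alpha(v)\cdot\#\pi_G^{-1}(\pi_H(v))$ for every $v\in V_H$. *Random sparse lift.* Let $\lambda:E_B\to(0,\infty)$ and, for each $e\in E_B$, let $\mathcal N_e$ be a Borel probability distribution with full support on $\mathcal W_e$. Let $n:V_B\to\mathbb N$ with $n_b=n^0_b$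 for $b\in I_B$. Let $C$ be the graph with vertices $(b,i)$, $b\in V_B$, $i\in[n_b]$, and with an edge from $(a,i)$ to $(b,j)$ exactly when $(a,b)\in E_B$; let $\pi$ be the first projection. Take independent random variables $m_e\sim\mathrm{Bern}(\lambda_{\pi(e)}/n_a)$ and $w_e\sim\mathcal N_{\pi(e)}$, for all edges $e$ of $C$, where $\pi(e)=(a,b)$. The random sparse lift $(G,w^0)$ of $\mathbb B$ along $(n,\lambda)$ with distribution $\mathcal N$ has the vertices of $C$, the edges $e$ with $m_e=1$, the homomorphism $\pi$, the identity input connection, and the weights $w^0=(w_e)_{e\in E_G}$. *The parameter $\alpha$.* Let $(G^\star,\pi_\star,c_\star)$, $G^\star=(V^\star,E^\star)$, be a lift (the witness) with parameters $w^\star$. For $\eta>0$ define $\alpha_\eta:V^\star\to(0,1]$ by recursion along the edges of $G^\star$: $\alpha_\eta(v)=1/n^0_{\pi_\star(v)}$ if $\pi_\star(v)\in I_B$, and otherwise $$\alpha_\eta(v)=\frac1{K_v}\prod_{a\in B(-,\pi_\star(v))}\frac{e^{-\lambda_{(a,\pi_\star(v))}}\lambda_{(a,\pi_\star(v))}^{k_a(v)}}{k_a(v)!}\prod_{u\in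 G^\star(-,v)}\mathcal N_{\pi_\star(u,v)}\bigl(\{x:\|x-w^\star_{(u,v)}\|\le\eta\}\bigr)\,\alpha_\eta(u),$$ with $K_v=2^{1+\#B(-,\pi_\star(v))}\cdot\#\pi_\star^{-1}(\pi_\star(v))$ and $k_a(v)=\#(G^\star(-,v)\cap\pi_\star^{-1}(a))$. **Proposition.** Let $\eta>0$, $R\ge0$, $\delta\in(0,1]$, and put $$\Lambda=\sum_{(a,b)\in E_B}\bigl(7\lambda_{(a,b)}+1+\log 2+\log(\#V^\star+\#E_B)-\log\delta\bigr).$$ Assume that $n_b\ge n_a\log n_a$ for all $(a,b)\in E_B$, that $\lambda_{(a,b)}\le\min\{n^0_a/2,(n^0_a/3)^{1/2}\}$ for all $(a,b)\in E_B$ with $a\in I_B$, and that $$n_b\ \ge\ 8\,\frac{(R+\eta)^2}{\eta^2}\,\frac{(1+\Lambda)^{1+\#V_B}}{\inf_{v\in V^\star}\alpha_{\eta/2}(v)}\qquad\text{for all }b\in V_B\setminus I_B .$$ Let $(G,w^0)$ be a random sparse lift of $\mathbb B$ along $(n,\lambda)$ with distribution $\mathcal N$. Then, with probability at least $1-\delta$,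 for every parameter $w$ of $G$ with $\|w-w^0\|\le R$, $(G,w)$ has a $(\tfrac12\alpha_{\eta/2},\eta)$-cover of $(G^\star,w^\star)$. -/

import Mathlib

open MeasureTheory ProbabilityTheory

namespace SparseLift

universe u v

/-! ### Finite directed graphs, homomorphisms, fibrations -/

/-- The edges of a directed graph, as a subtype of the pairs of vertices. -/
abbrev Edge {V : Type*} (G : Digraph V) : Type _ := {e : V × V // G.Adj e.1 e.2}

noncomputable instance {V : Type*} [Fintype V] (G : Digraph V) : Fintype (Edge G) :=
  Fintype.ofFinite _

/-- The set `G(-,v)` of parents of a vertex. -/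
def parents {V : Type*} (G : Digraph V) (v : V) : Set V := {u | G.Adj u v}

/-- A directed graph is acyclic if its edges increase along some total order of the vertices. -/
class Acyclic {V : Type*} (G : Digraph V) : Prop where
  exists_order : ∃ _ : LinearOrder V, ∀ a b, G.Adj a b → a < b

/-- Homomorphisms of directed graphs. -/
def IsHom {V V' : Type*} (G : Digraph V) (H : Digraph V') (f : V → V') : Prop :=
  ∀ a b, G.Adj a b → H.Adj (f a) (f b)

/-- The action of a homomorphism on edges. -/
def mapEdge {V V' : Type*} {G : Digraph V} {H : Digraph V'} {f : V → V'}
    (hf : IsHom G H f) (e : Edge G) : Edge H :=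
  ⟨(f e.1.1, f e.1.2), hf _ _ e.2⟩

/-- A fibration is a homomorphism that restricts to bijections of in-neighbourhoods. -/
structure IsFibration {V V' : Type*} (G : Digraph V) (H : Digraph V') (f : V → V') : Prop where
  hom : IsHom G H f
  bijOn : ∀ v, Set.BijOn f (parents G v) (parents H (f v))

theorem wellFounded_of_hom {V V' : Type*} [Finite V'] {G : Digraph V} {H : Digraph V'}
    [hH : Acyclic H] {f : V → V'} (hf : IsHom G H f) : WellFounded G.Adj := by
  obtain ⟨_, hlt⟩ := hH.exists_order
  exact Subrelation.wf (r := InvImage (· < ·) f) (fun h => hlt _ _ (hf _ _ h))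
    (InvImage.wf f (wellFounded_lt (α := V')))

/-! ### Perceptron modules and their lifts -/

/-- A perceptron module over the graph `B` : initial and terminal vertices, Euclidean bundles of
activations `Y`, pre-activations `Z` and weights `W`, and the maps `M` and `σ`. -/
structure PMod {VB : Type u} (B : Digraph VB) where
  I : Set VB
  T : Set VB
  parents_eq_empty : ∀ b ∈ I, parents B b = ∅
  Y : VB → Type v
  Z : Edge B → Type v
  W : Edge B → Type v
  [normedY : ∀ b, NormedAddCommGroup (Y b)]
  [innerY : ∀ b, InnerProductSpace ℝ (Y b)]
  [finDimY : ∀ b, FiniteDimensional ℝ (Y b)]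
  [normedZ : ∀ e, NormedAddCommGroup (Z e)]
  [innerZ : ∀ e, InnerProductSpace ℝ (Z e)]
  [finDimZ : ∀ e, FiniteDimensional ℝ (Z e)]
  [normedW : ∀ e, NormedAddCommGroup (W e)]
  [innerW : ∀ e, InnerProductSpace ℝ (W e)]
  [finDimW : ∀ e, FiniteDimensional ℝ (W e)]
  M : ∀ e : Edge B, W e → Y e.1.1 → Z e
  σ : ∀ b : VB, b ∉ I → (∀ a : parents B b, Z ⟨(a.1, b), a.2⟩) → Y b

attribute [instance] PMod.normedY PMod.innerY PMod.finDimY PMod.normedZ PMod.innerZ PMod.finDimZ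
  PMod.normedW PMod.innerW PMod.finDimW

section Lifts

variable {VB : Type u} {B : Digraph VB}

instance (𝔹 : PMod.{u, v} B) (e : Edge B) : MeasurableSpace (𝔹.W e) := borel _

instance (𝔹 : PMod.{u, v} B) (e : Edge B) : BorelSpace (𝔹.W e) := ⟨rfl⟩

/-- The finite set of lifted inputs, with `n0 b` inputs of each type `b`. -/
abbrev Inputs (𝔹 : PMod.{u, v} B) (n0 : 𝔹.I → ℕ) : Type u := Σ b : 𝔹.I, Fin (n0 b)

/-- A lift of a perceptron module: a finite graph, a homomorphism `π` to the base graph and an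
injective assignment `c` of its initial vertices to the lifted inputs, compatible with types. -/
structure Lift (𝔹 : PMod.{u, v} B) (n0 : 𝔹.I → ℕ) where
  V : Type u
  [fintypeV : Fintype V]
  graph : Digraph V
  π : V → VB
  hom : IsHom graph B π
  c : {x : V // π x ∈ 𝔹.I} → Inputs 𝔹 n0
  c_injective : Function.Injective c
  c_type : ∀ x, ((c x).1 : VB) = π x.1

attribute [instance] Lift.fintypeV

variable {𝔹 : PMod.{u, v} B} {n0 : 𝔹.I → ℕ}

/-- The type in the base graph of an edge of a lift. -/
abbrev Lift.edgeType (G : Lift 𝔹 n0) (e : Edge G.graph) : Edge B := mapEdge G.hom e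

/-- The parameter space of a lift: one copy of `W (π e)` for each edge `e`. -/
abbrev Param (G : Lift 𝔹 n0) : Type _ := ∀ e : Edge G.graph, 𝔹.W (G.edgeType e)

/-- The Euclidean distance on the parameter space. -/
noncomputable def paramDist {G : Lift 𝔹 n0} (w w' : Param G) : ℝ :=
  Real.sqrt (∑ e, ‖w e - w' e‖ ^ 2)

/-- Number `#π⁻¹(b)` of vertices of type `b`. -/
noncomputable def Lift.width (G : Lift 𝔹 n0) (b : VB) : ℕ := (G.π ⁻¹' {b}).ncard

/-! ### Morphisms, partial morphisms, covers -/

/-- Morphisms of lifts: fibrations that preserve types and input connections. -/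
structure IsMorphism (G H : Lift 𝔹 n0) (φ : G.V → H.V) : Prop where
  fibration : IsFibration G.graph H.graph φ
  type_eq : ∀ x, H.π (φ x) = G.π x
  input_eq : ∀ (x : G.V) (hx : G.π x ∈ 𝔹.I) (hx' : H.π (φ x) ∈ 𝔹.I),
    H.c ⟨φ x, hx'⟩ = G.c ⟨x, hx⟩

/-- A subgraph: a set of vertices, and a set of edges between them contained in those of `G`. -/
structure Subgraph {V : Type*} (G : Digraph V) where
  verts : Set V
  graph : Digraph verts
  incl : IsHom graph G Subtype.val

/-- The lift `(S, π|_S, c|_S)` carried by a subgraph `S` of a lift. -/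
noncomputable def Lift.restrict (G : Lift 𝔹 n0) (S : Subgraph G.graph) : Lift 𝔹 n0 where
  V := S.verts
  fintypeV := Fintype.ofFinite _
  graph := S.graph
  π := fun x => G.π x
  hom := fun _ _ h => G.hom _ _ (S.incl _ _ h)
  c := fun x => G.c ⟨x.1.1, x.2⟩
  c_injective := fun x y h => by
    have h' := G.c_injective h
    exact Subtype.ext (Subtype.ext (congrArg (fun z => z.1) h'))
  c_type := fun x => G.c_type ⟨x.1.1, x.2⟩

/-- A partial morphism `(S, φ)` from `G` to `H`: a subgraph `S` of `G` whose inclusion is a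
morphism (so `S` contains every parent and every incoming edge of its vertices), with a morphism
from `S` to `H`. -/
structure PartialMorphism (G H : Lift 𝔹 n0) where
  S : Subgraph G.graph
  φ : S.verts → H.V
  incl : IsMorphism (G.restrict S) G Subtype.val
  morphism : IsMorphism (G.restrict S) H φ

/-- Transport of a weight along an equality of edges of the base graph. -/
def castW (𝔹 : PMod.{u, v} B) {e e' : Edge B} (h : e = e') (x : 𝔹.W e) : 𝔹.W e' := h ▸ x

theorem PartialMorphism.edgeType_eq {G H : Lift 𝔹 n0} (F : PartialMorphism G H)
    (e : Edge F.S.graph) :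
    H.edgeType (mapEdge F.morphism.fibration.hom e) = G.edgeType (mapEdge F.S.incl e) :=
  Subtype.ext (Prod.ext (F.morphism.type_eq _) (F.morphism.type_eq _))

/-- `(S, φ)` is an `(α, η)`-covering: weights match up to `η` on every edge of `S`, and every
vertex `x` of `H` has at least `α x * #π_G⁻¹(π_H x)` preimages. -/
structure PartialMorphism.IsCovering {G H : Lift 𝔹 n0} (F : PartialMorphism G H)
    (wG : Param G) (wH : Param H) (α : H.V → ℝ) (η : ℝ) : Prop where
  weights : ∀ e : Edge F.S.graph,
    ‖wG (mapEdge F.S.incl e) -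
      castW 𝔹 (F.edgeType_eq e) (wH (mapEdge F.morphism.fibration.hom e))‖ ≤ η
  volume : ∀ x : H.V, α x * (G.width (H.π x) : ℝ) ≤ ((F.φ ⁻¹' {x}).ncard : ℝ)

/-- `(G, wG)` has an `(α, η)`-cover of `(H, wH)`. -/
def HasCover {G H : Lift 𝔹 n0} (wG : Param G) (wH : Param H) (α : H.V → ℝ) (η : ℝ) : Prop :=
  ∃ F : PartialMorphism G H, F.IsCovering wG wH α η

/-! ### The parameter `α` -/

/-- The Poisson density. -/
noncomputable def poissonDensity (k : ℕ) (lam : ℝ) : ℝ :=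
  Real.exp (-lam) * lam ^ k / (k.factorial : ℝ)

/-- The number `k_a(x)` of parents of type `a` of a vertex `x` of a lift. -/
noncomputable def Lift.numParents (G : Lift 𝔹 n0) (a : VB) (x : G.V) : ℕ :=
  (parents G.graph x ∩ G.π ⁻¹' {a}).ncard

/-- The factor `K_x = 2 ^ (1 + #B(-, π x)) * #π⁻¹(π x)`. -/
noncomputable def Lift.normalizer (G : Lift 𝔹 n0) (x : G.V) : ℝ :=
  2 ^ (1 + (parents B (G.π x)).ncard) * (G.width (G.π x) : ℝ)

theorem Lift.wellFounded [Finite VB] [Acyclic B] (G : Lift 𝔹 n0) : WellFounded G.graph.Adj :=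
  wellFounded_of_hom G.hom

open scoped Classical in
/-- The `α`-parameter of a lift with weights `w`, by recursion along the edges of its graph. At an
initial vertex of type `b` it is `1 / n0 b`, where `n0 b` is the number of inputs of type `b`. -/
noncomputable def alpha [Fintype VB] [Acyclic B] (lam : Edge B → ℝ)
    (N : ∀ e : Edge B, Measure (𝔹.W e)) (G : Lift 𝔹 n0) (w : Param G) (η : ℝ) : G.V → ℝ :=
  G.wellFounded.fix fun x rec =>
    if h : G.π x ∈ 𝔹.I then 1 / (n0 ⟨G.π x, h⟩ : ℝ)
    else
      1 / G.normalizer x *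
        (∏ a : parents B (G.π x), poissonDensity (G.numParents a x) (lam ⟨(a.1, G.π x), a.2⟩)) *
        ∏ y : parents G.graph x,
          (N (G.edgeType ⟨(y.1, x), y.2⟩)).real (Metric.closedBall (w ⟨(y.1, x), y.2⟩) η) *
            rec y.1 y.2

open scoped Classical in
theorem alpha_eq [Fintype VB] [Acyclic B] (lam : Edge B → ℝ)
    (N : ∀ e : Edge B, Measure (𝔹.W e)) (G : Lift 𝔹 n0) (w : Param G) (η : ℝ) (x : G.V) :
    alpha lam N G w η x =
      if h : G.π x ∈ 𝔹.I then 1 / (n0 ⟨G.π x, h⟩ : ℝ)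
      else
        1 / G.normalizer x *
          (∏ a : parents B (G.π x), poissonDensity (G.numParents a x) (lam ⟨(a.1, G.π x), a.2⟩)) *
          ∏ y : parents G.graph x,
            (N (G.edgeType ⟨(y.1, x), y.2⟩)).real (Metric.closedBall (w ⟨(y.1, x), y.2⟩) η) *
              alpha lam N G w η y.1 :=
  G.wellFounded.fix_eq _ x

/-- The constant `Λ`, where `k` stands for the number of vertices of the witness graph. -/
noncomputable def bigLambda [Fintype VB] (lam : Edge B → ℝ) (k : ℕ) (δ : ℝ) : ℝ :=
  ∑ e : Edge B, (7 * lam e + 1 + Real.log 2 + Real.log ((k : ℝ) + (Fintype.card (Edge B) : ℝ))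
    - Real.log δ)

/-! ### Random sparse lifts -/

/-- The fully-connected lift of a graph along the widths `n`. -/
def fcGraph (B : Digraph VB) (n : VB → ℕ) : Digraph (Σ b, Fin (n b)) where
  Adj x y := B.Adj x.1 y.1

/-- The subgraph of the fully-connected lift whose edges are selected by the mask `m`. -/
def sparseGraph {n : VB → ℕ} (m : Edge (fcGraph B n) → Bool) : Digraph (Σ b, Fin (n b)) where
  Adj x y := ∃ h : (fcGraph B n).Adj x y, m ⟨(x, y), h⟩ = true

/-- The type in the base graph of an edge of the fully-connected lift. -/
def fcType {n : VB → ℕ} (e : Edge (fcGraph B n)) : Edge B :=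
  ⟨(e.1.1.1, e.1.2.1), e.2⟩

/-- The lift over the graph selected by the mask `m`, with the first projection as homomorphism and
the identity as input connection. -/
def sparseLift [Fintype VB] {n : VB → ℕ} (hn : ∀ b : 𝔹.I, n b = n0 b)
    (m : Edge (fcGraph B n) → Bool) : Lift 𝔹 n0 where
  V := Σ b, Fin (n b)
  graph := sparseGraph m
  π := Sigma.fst
  hom := fun _ _ h => h.1
  c := fun x => ⟨⟨x.1.1, x.2⟩, Fin.cast (hn ⟨x.1.1, x.2⟩) x.1.2⟩
  c_injective := by
    rintro ⟨⟨b, i⟩, hb⟩ ⟨⟨b', i'⟩, hb'⟩ h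
    obtain rfl : b = b' := congrArg (fun z : Inputs 𝔹 n0 => (z.1 : VB)) h
    simpa [Fin.ext_iff] using h
  c_type := fun _ => rfl

/-- Restriction of the weights of the fully-connected lift to the edges selected by `m`. -/
def restrictParam [Fintype VB] {n : VB → ℕ} (hn : ∀ b : 𝔹.I, n b = n0 b)
    (m : Edge (fcGraph B n) → Bool) (w : ∀ e : Edge (fcGraph B n), 𝔹.W (fcType e)) :
    Param (sparseLift hn m) :=
  fun e => w ⟨e.1, e.2.1⟩

/-- The masks `m` and weights `w` on the edges of the fully-connected lift are independent random
variables, with `m e` Bernoulli of parameter `lam (π e) / n a` when `e` starts at a vertex of type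
`a`, and `w e` of law `N (π e)`. The random sparse lift is then `sparseLift hn (m · ω)`, with
weights `restrictParam hn (m · ω) (w · ω)`. -/
structure IsRandomSparseLift {Ω : Type*} [MeasurableSpace Ω] (P : Measure Ω)
    {n : VB → ℕ} (lam : Edge B → ℝ)
    (N : ∀ e : Edge B, Measure (𝔹.W e))
    (m : Edge (fcGraph B n) → Ω → Bool)
    (w : ∀ e : Edge (fcGraph B n), Ω → 𝔹.W (fcType e)) : Prop where
  measurable_mask : ∀ e, Measurable (m e)
  measurable_weight : ∀ e, Measurable (w e)
  indep_mask : iIndepFun m P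
  indep_weight : iIndepFun w P
  indep_mask_weight : IndepFun (fun ω e => m e ω) (fun ω e => w e ω) P
  mask_law : ∀ e, P {ω | m e ω = true} =
    ENNReal.ofReal (lam (fcType e) / (n e.1.1.1 : ℝ))
  weight_law : ∀ e, P.map (w e) = N (fcType e)

end Lifts

end SparseLift

/-! Give every vertex of the fully-connected lift a tag in advance: a witness vertex of its own
type, or none. Inputs are tagged through the input connection of the witness, other types by an even
split, so that `v` of type `b` receives at least `⌊n b / width b⌋` vertices (`exists_tag`). Then
only two bits per edge matter: its presence, and whether its weight is within `η / 2` of the one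
prescribed by the tags (`config`). A vertex tagged `v` is covered if its present in-edges are good
and come from exactly one covered vertex tagged `u` for each parent `u` of `v`. Covered vertices are
closed under parents, and the tag is a fibration on them.

Many vertices are covered. Freeze the covered vertices of lower rank, assuming at least `α u * n a`
of them over each `u`. Choosing one source for each parent, a vertex tagged `v` matches with
probability at least the product of the `α u * n a * (lam / n a) * N(ball)` times `∏ (1 - lam / n a)
^ n a ≥ ∏ exp(-lam) / 2`. The normalizer in `alpha` is such that this is at least `2 * width b * α
v`. Matches of distinct vertices are independent, so the mean count is at least `2 * α v * n b - 1`,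
and a Chernoff bound gives `α v * n b` outside probability `exp(-(1 + Λ))`. Freezing is legitimate
because edges into different ranks are independent (`measureReal_first_failure_le`).

Covers survive perturbation. If `‖w - w0‖ ≤ R`, at most `4 R² / η²` weights move by more than `η /
2`. Discarding the heads of these edges and all their descendants keeps the set closed under
parents, with weights within `η / 2 + η / 2`. Out-degrees are at most `L e * n b / n a` with high
probability; the growth of `n` pays for the union over the `n a` sources. Hence the discarded
proportion grows by at most `1 + Λ` per rank (`card_affected_le`), and the width assumption keeps it
below half of the covered vertices. The probabilistic events do not involve `w`, so the conclusion
holds for all `w` at once. A union bound over witness vertices and base edges gives `δ`. -/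

namespace SparseLift

/-! ### Independence of finite-valued variables, and Chernoff bounds. -/

section Probability

variable {Ω : Type*} [MeasurableSpace Ω] {P : Measure Ω}

/-- Independence of finitely many finitely-valued random variables can be checked on singletons. -/
theorem iIndepFun_of_singleton [IsProbabilityMeasure P] {ι : Type*} [Fintype ι] {β : ι → Type*}
    [∀ i, MeasurableSpace (β i)] [∀ i, MeasurableSingletonClass (β i)] [∀ i, Finite (β i)]
    {X : ∀ i, Ω → β i} (hX : ∀ i, Measurable (X i))
    (h : ∀ s : ∀ i, β i, P {ω | ∀ i, X i ω = s i} = ∏ i, P {ω | X i ω = s i}) :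
    iIndepFun X P := by
  rw [iIndepFun_iff_map_fun_eq_pi_map (fun i => (hX i).aemeasurable)]
  have hm : Measurable (fun ω i => X i ω) := measurable_pi_lambda _ hX
  have : ∀ i, IsProbabilityMeasure (P.map (X i)) := fun i =>
    Measure.isProbabilityMeasure_map (hX i).aemeasurable
  refine Measure.ext_of_singleton fun s => ?_
  rw [Measure.pi_singleton, Measure.map_apply hm (measurableSet_singleton _)]
  have h1 : (fun ω i => X i ω) ⁻¹' {s} = {ω | ∀ i, X i ω = s i} := by
    ext ω; simp [funext_iff]
  rw [h1, h]
  refine Finset.prod_congr rfl fun i _ => ?_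
  rw [Measure.map_apply (hX i) (measurableSet_singleton _)]
  rfl

theorem iIndepFun.measure_forall_eq {ι : Type*} [Fintype ι] {β : ι → Type*}
    [∀ i, MeasurableSpace (β i)] [∀ i, MeasurableSingletonClass (β i)]
    {X : ∀ i, Ω → β i} (h : iIndepFun X P) (s : ∀ i, β i) :
    P {ω | ∀ i, X i ω = s i} = ∏ i, P {ω | X i ω = s i} := by
  have := h.meas_iInter (s := fun i => X i ⁻¹' {s i})
    (fun i => ⟨{s i}, measurableSet_singleton _, rfl⟩)
  convert this using 2
  · ext ω; simp
  · rfl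

/-- Restrictions of independent variables to the fibres of a map of index sets are independent. -/
theorem iIndepFun.fiberwise [IsProbabilityMeasure P] {E K S : Type*} [Fintype E] [Fintype K]
    [MeasurableSpace S] [MeasurableSingletonClass S] [Finite S]
    {X : E → Ω → S} (hX : ∀ e, Measurable (X e)) (h : iIndepFun X P) (κ : E → K) :
    iIndepFun (fun k ω (e : {e // κ e = k}) => X e ω) P := by
  classical
  refine iIndepFun_of_singleton (fun k => measurable_pi_lambda _ fun e => hX e) fun s => ?_
  have h1 : {ω | ∀ k, (fun e : {e // κ e = k} => X e ω) = s k} =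
      {ω | ∀ e, X e ω = s (κ e) ⟨e, rfl⟩} := by
    ext ω
    simp only [funext_iff, Set.mem_ofPred_eq, Subtype.forall]
    exact ⟨fun H e => H _ e rfl, fun H k e he => by subst he; exact H e⟩
  have h2 : ∀ k, P {ω | (fun e : {e // κ e = k} => X e ω) = s k} =
      ∏ e : {e // κ e = k}, P {ω | X e ω = s k e} := fun k => by
    rw [← iIndepFun.measure_forall_eq (h.precomp (g := fun e : {e // κ e = k} => e.1)
      Subtype.val_injective)]
    simp only [funext_iff]
  rw [h1, iIndepFun.measure_forall_eq h]
  simp_rw [h2]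
  rw [← Fintype.prod_sigma' (f := fun k (e : {e // κ e = k}) => P {ω | X e ω = s k e})]
  refine Fintype.prod_equiv (Equiv.sigmaFiberEquiv κ).symm _ _ fun e => ?_
  rfl

/-- Two independent families that are independent of each other form an independent family of
pairs. -/
theorem iIndepFun.prodMk_of_indepFun [IsProbabilityMeasure P] {E S T : Type*} [Fintype E]
    [MeasurableSpace S] [MeasurableSingletonClass S] [Finite S]
    [MeasurableSpace T] [MeasurableSingletonClass T] [Finite T]
    {X : E → Ω → S} {Y : E → Ω → T} (hX : ∀ e, Measurable (X e)) (hY : ∀ e, Measurable (Y e))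
    (hiX : iIndepFun X P) (hiY : iIndepFun Y P)
    (hXY : IndepFun (fun ω e => X e ω) (fun ω e => Y e ω) P) :
    iIndepFun (fun e ω => (X e ω, Y e ω)) P := by
  refine iIndepFun_of_singleton (fun e => (hX e).prodMk (hY e)) fun s => ?_
  have h1 : {ω | ∀ e, (X e ω, Y e ω) = s e} =
      (fun ω e => X e ω) ⁻¹' {fun e => (s e).1} ∩ (fun ω e => Y e ω) ⁻¹' {fun e => (s e).2} := by
    ext ω; simp [Prod.ext_iff, funext_iff, forall_and]
  have h2 : ∀ e, P {ω | (X e ω, Y e ω) = s e} =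
      P {ω | X e ω = (s e).1} * P {ω | Y e ω = (s e).2} := fun e => by
    have := (hXY.comp (measurable_pi_apply e) (measurable_pi_apply e)).measure_inter_preimage_eq_mul
      {(s e).1} {(s e).2} (measurableSet_singleton _) (measurableSet_singleton _)
    convert this using 2
    · ext ω; simp [Prod.ext_iff]
    · congr 1
    · congr 1
  rw [h1, hXY.measure_inter_preimage_eq_mul _ _ (measurableSet_singleton _)
    (measurableSet_singleton _)]
  simp_rw [h2]
  rw [Finset.prod_mul_distrib, ← iIndepFun.measure_forall_eq hiX,
    ← iIndepFun.measure_forall_eq hiY]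
  congr 2 <;> ext ω <;> simp [funext_iff]

/-- If `X` and `Y` are independent and `Y` avoids the set `F s` with high probability for every
`s ∈ A`, then it avoids `F X` with high probability on the event `X ∈ A`. -/
theorem IndepFun.measureReal_le_of_forall [IsProbabilityMeasure P] {S T : Type*} [Fintype S]
    [MeasurableSpace S] [MeasurableSingletonClass S] [MeasurableSpace T]
    {X : Ω → S} {Y : Ω → T} (hX : Measurable X) (h : IndepFun X Y P)
    (A : Set S) (F : S → Set T) (hF : ∀ s, MeasurableSet (F s)) {ε : ℝ} (hε : 0 ≤ ε)
    (hle : ∀ s ∈ A, P.real {ω | Y ω ∈ F s} ≤ ε) :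
    P.real {ω | X ω ∈ A ∧ Y ω ∈ F (X ω)} ≤ ε := by
  classical
  have h1 : {ω | X ω ∈ A ∧ Y ω ∈ F (X ω)} ⊆
      ⋃ s ∈ (Finset.univ.filter (· ∈ A)), X ⁻¹' {s} ∩ Y ⁻¹' (F s) := fun ω hω => by
    simpa using hω
  calc P.real {ω | X ω ∈ A ∧ Y ω ∈ F (X ω)}
      ≤ P.real (⋃ s ∈ (Finset.univ.filter (· ∈ A)), X ⁻¹' {s} ∩ Y ⁻¹' (F s)) :=
        measureReal_mono h1 (measure_ne_top _ _)
    _ ≤ ∑ s ∈ (Finset.univ.filter (· ∈ A)), P.real (X ⁻¹' {s} ∩ Y ⁻¹' (F s)) :=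
        measureReal_biUnion_finset_le _ _
    _ ≤ ∑ s ∈ (Finset.univ.filter (· ∈ A)), P.real (X ⁻¹' {s}) * ε := by
        refine Finset.sum_le_sum fun s hs => ?_
        have := h.measure_inter_preimage_eq_mul {s} (F s) (measurableSet_singleton _) (hF s)
        rw [measureReal_def, this, ENNReal.toReal_mul]
        exact mul_le_mul_of_nonneg_left (hle s (by simpa using hs)) ENNReal.toReal_nonneg
    _ ≤ ∑ s, P.real (X ⁻¹' {s}) * ε :=
        Finset.sum_le_sum_of_subset_of_nonneg (Finset.subset_univ _)
          fun _ _ _ => mul_nonneg measureReal_nonneg hε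
    _ = ε := by
        rw [← Finset.sum_mul, sum_measureReal_preimage_singleton _
          (fun s _ => hX (measurableSet_singleton s))]
        simp

/-- Exponential moments of a count of independent events. -/
theorem mgf_count_le [IsProbabilityMeasure P] {ι : Type*} [Fintype ι] {Y : ι → Ω → Bool}
    (hY : ∀ i, Measurable (Y i)) (h : iIndepFun Y P) (t : ℝ) :
    mgf (∑ i, fun ω => if Y i ω = true then (1 : ℝ) else 0) P t ≤
      Real.exp ((Real.exp t - 1) * ∑ i, P.real {ω | Y i ω = true}) := by
  have hm : Measurable (fun b : Bool => if b = true then (1 : ℝ) else 0) := .of_discrete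
  have h1 := iIndepFun.mgf_sum (t := t) (h.comp (fun _ b => if b = true then (1 : ℝ) else 0)
    (fun _ => hm)) (fun i => hm.comp (hY i)) Finset.univ
  refine h1.le.trans ?_
  rw [Finset.mul_sum, Real.exp_sum]
  refine Finset.prod_le_prod (fun i _ => mgf_nonneg) fun i _ => ?_
  have hs : MeasurableSet {ω | Y i ω = true} := hY i (measurableSet_singleton true)
  have h2 : (fun ω => Real.exp (t * ((fun b : Bool => if b = true then (1 : ℝ) else 0) ∘ Y i) ω)) =
      fun ω => {ω | Y i ω = true}.indicator (fun _ => Real.exp t - 1) ω + 1 := by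
    ext ω
    by_cases hω : Y i ω = true <;> simp [hω]
  have h3 : mgf ((fun b : Bool => if b = true then (1 : ℝ) else 0) ∘ Y i) P t =
      (Real.exp t - 1) * P.real {ω | Y i ω = true} + 1 := by
    rw [mgf, h2, integral_add ((integrable_const _).indicator hs) (integrable_const _),
      integral_indicator_const _ hs]
    simp [mul_comm]
  rw [h3]
  -- Each factor `1 + (e^t - 1) p` is at most `exp ((e^t - 1) p)`, for either sign of `t`.
  exact Real.add_one_le_exp _

theorem integrable_exp_count [IsProbabilityMeasure P] {ι : Type*} [Fintype ι] {Y : ι → Ω → Bool}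
    (hY : ∀ i, Measurable (Y i)) (t : ℝ) :
    Integrable (fun ω => Real.exp (t * (∑ i, fun ω => if Y i ω = true then (1 : ℝ) else 0) ω))
      P := by
  have hm : Measurable (fun b : ι → Bool => Real.exp (t * ∑ i, if b i = true then (1 : ℝ) else 0)) :=
    .of_discrete
  obtain ⟨C, hC⟩ := (Set.finite_range (fun b : ι → Bool =>
    Real.exp (t * ∑ i, if b i = true then (1 : ℝ) else 0))).bddAbove
  refine Integrable.of_bound (C := C) ?_ (.of_forall fun ω => ?_)
  · have := (hm.comp (measurable_pi_lambda _ hY)).aestronglyMeasurable (μ := P)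
    simpa [Function.comp_def] using this
  · rw [Real.norm_eq_abs, abs_of_pos (Real.exp_pos _)]
    have := hC ⟨fun i => Y i ω, rfl⟩
    simpa using this

/-- Chernoff's bound at the fixed exponent `t = 1`. Thresholds will exceed the mean by a constant
factor, so optimizing in `t` is unnecessary; the lower tail likewise takes `t = -1`. -/
theorem count_upper_tail [IsProbabilityMeasure P] {ι : Type*} [Fintype ι] {Y : ι → Ω → Bool}
    (hY : ∀ i, Measurable (Y i)) (h : iIndepFun Y P) (T : ℝ) :
    P.real {ω | T ≤ ∑ i, if Y i ω = true then (1 : ℝ) else 0} ≤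
      Real.exp (-T + (Real.exp 1 - 1) * ∑ i, P.real {ω | Y i ω = true}) := by
  have h1 := measure_ge_le_exp_mul_mgf T zero_le_one (integrable_exp_count (P := P) hY 1)
  simp only [Finset.sum_apply] at h1
  refine h1.trans ?_
  rw [Real.exp_add, neg_one_mul]
  exact mul_le_mul_of_nonneg_left (mgf_count_le hY h 1) (Real.exp_pos _).le

theorem count_lower_tail [IsProbabilityMeasure P] {ι : Type*} [Fintype ι] {Y : ι → Ω → Bool}
    (hY : ∀ i, Measurable (Y i)) (h : iIndepFun Y P) (T : ℝ) :
    P.real {ω | ∑ i, (if Y i ω = true then (1 : ℝ) else 0) ≤ T} ≤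
      Real.exp (T + (Real.exp (-1) - 1) * ∑ i, P.real {ω | Y i ω = true}) := by
  have h1 := measure_le_le_exp_mul_mgf T (by norm_num : (-1 : ℝ) ≤ 0)
    (integrable_exp_count (P := P) hY (-1))
  simp only [Finset.sum_apply] at h1
  refine h1.trans ?_
  rw [Real.exp_add, neg_neg, one_mul]
  exact mul_le_mul_of_nonneg_left (mgf_count_le hY h (-1)) (Real.exp_pos _).le

end Probability

/-- Source of the factor 2 per parent type in `Lift.normalizer`: the probability that all `n`
potential edges from one type are absent is nearly the Poisson value `exp (-x)`, with a loss of at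
most one half. -/
theorem half_exp_neg_le_one_sub_div_pow {x : ℝ} {n : ℕ} (hx : 0 ≤ x) (h1 : x ≤ n / 2)
    (h2 : x ^ 2 ≤ n / 3) : 1 / 2 * Real.exp (-x) ≤ (1 - x / n) ^ n := by
  rcases Nat.eq_zero_or_pos n with rfl | hn
  · have : x = 0 := le_antisymm (by simpa using h1) hx
    subst this; norm_num
  have hn' : (0 : ℝ) < n := by exact_mod_cast hn
  set y := x / n with hy
  have hxy : x = y * n := by rw [hy]; field_simp
  have hy0 : 0 ≤ y := by positivity
  have hy2 : y ≤ 1 / 2 := by rw [hy, div_le_iff₀ hn']; linarith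
  -- From `log z ≥ 1 - 1/z` one gets `log (1 - y) ≥ -y / (1 - y)`, and `y ≤ 1/2` absorbs the
  -- denominator.
  have hlog : -y - 2 * y ^ 2 ≤ Real.log (1 - y) := by
    refine le_trans ?_ (Real.one_sub_inv_le_log_of_pos (by linarith))
    have hpos : 0 < 1 - y := by linarith
    have : 1 - (1 - y)⁻¹ = -y / (1 - y) := by field_simp; ring
    rw [this, le_div_iff₀ hpos]
    nlinarith [mul_nonneg (sq_nonneg y) (by linarith : (0 : ℝ) ≤ 1 - 2 * y)]
  have h3 : n * y ^ 2 ≤ 1 / 3 := by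
    rw [hxy] at h2
    have : n * (n * y ^ 2) ≤ n * (1 / 3) := by nlinarith
    exact le_of_mul_le_mul_left this hn'
  -- The quadratic error is `2 n y² ≤ 2/3`, just below `log 2`.
  have hl2 : Real.exp (-(2 / 3)) ≥ 1 / 2 := by
    rw [ge_iff_le, ← Real.log_le_iff_le_exp (by norm_num)]
    rw [one_div, Real.log_inv]
    have := Real.log_two_gt_d9
    linarith
  calc 1 / 2 * Real.exp (-x) ≤ Real.exp (-(2 / 3)) * Real.exp (-x) :=
        mul_le_mul_of_nonneg_right hl2 (Real.exp_pos _).le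
    _ = Real.exp (-(2 / 3) + -x) := (Real.exp_add _ _).symm
    _ ≤ Real.exp (n * Real.log (1 - y)) := by
        refine Real.exp_le_exp.2 ?_
        have := mul_le_mul_of_nonneg_left hlog hn'.le
        rw [hxy]; nlinarith
    _ = (1 - y) ^ n := by
        rw [Real.exp_nat_mul, Real.exp_log (by linarith)]

/-- Vertices reached by a path whose first edge is bad. -/
inductive Affected {V : Type*} (G : Digraph V) (bad : Edge G → Prop) : V → Prop
  | head (e : Edge G) (he : bad e) : Affected G bad e.1.2
  | step (e : Edge G) (he : Affected G bad e.1.1) : Affected G bad e.1.2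

/-! ### Covered vertices, the cover they carry, and the spread of bad edges. -/

section Deterministic

universe u v

variable {VB : Type u} {B : Digraph VB} {𝔹 : PMod.{u, v} B} {n0 : 𝔹.I → ℕ} {n : VB → ℕ}

theorem exists_rank [Fintype VB] (B : Digraph VB) [hB : Acyclic B] :
    ∃ r : VB → ℕ, (∀ a b, B.Adj a b → r a < r b) ∧ ∀ b, r b ≤ Fintype.card VB := by
  classical
  obtain ⟨_, hlt⟩ := hB.exists_order
  refine ⟨fun b => (Finset.univ.filter (· < b)).card, fun a b h => ?_, fun b => Finset.card_le_univ _⟩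
  refine Finset.card_lt_card ⟨fun c hc => ?_, fun H => ?_⟩
  · simp only [Finset.mem_filter, Finset.mem_univ, true_and] at hc ⊢
    exact hc.trans (hlt a b h)
  · have : a ∈ Finset.univ.filter (· < a) := H (by simpa using hlt a b h)
    simp at this

/-- A vertex of the fully-connected lift matches the vertex of `H` prescribed by `tag` when its
incoming edges in the configuration `ξ` are good and come from exactly one vertex of `s` for each
parent. The components of `ξ` record the presence and the quality of edges. -/
def IsMatch (H : Lift 𝔹 n0) (tag : (Σ b, Fin (n b)) → Option H.V) (s : (Σ b, Fin (n b)) → Prop)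
    (ξ : Edge (fcGraph B n) → Bool × Bool) (x : Σ b, Fin (n b)) : Prop :=
  ∃ v, tag x = some v ∧ ∃ f : parents H.graph v → Σ b, Fin (n b),
    (∀ u, tag (f u) = some u.1) ∧ (∀ u, s (f u)) ∧
    (∀ u, ∃ h : (fcGraph B n).Adj (f u) x, ξ ⟨(f u, x), h⟩ = (true, true)) ∧
    ∀ y (h : (fcGraph B n).Adj y x), (ξ ⟨(y, x), h⟩).1 = true → ∃ u, f u = y

/-- The vertices all of whose ancestors match their tags. -/
inductive Covered (H : Lift 𝔹 n0) (tag : (Σ b, Fin (n b)) → Option H.V)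
    (ξ : Edge (fcGraph B n) → Bool × Bool) : (Σ b, Fin (n b)) → Prop
  | mk (x : Σ b, Fin (n b)) (v : H.V) (hx : tag x = some v) (f : parents H.graph v → Σ b, Fin (n b))
      (htag : ∀ u, tag (f u) = some u.1) (hf : ∀ u, Covered H tag ξ (f u))
      (hgood : ∀ u, ∃ h : (fcGraph B n).Adj (f u) x, ξ ⟨(f u, x), h⟩ = (true, true))
      (hall : ∀ y (h : (fcGraph B n).Adj y x), (ξ ⟨(y, x), h⟩).1 = true → ∃ u, f u = y) :
      Covered H tag ξ x

theorem covered_iff {H : Lift 𝔹 n0} {tag : (Σ b, Fin (n b)) → Option H.V}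
    {ξ : Edge (fcGraph B n) → Bool × Bool} {x : Σ b, Fin (n b)} :
    Covered H tag ξ x ↔ IsMatch H tag (Covered H tag ξ) ξ x := by
  constructor
  · rintro ⟨_, v, hx, f, h1, h2, h3, h4⟩
    exact ⟨v, hx, f, h1, h2, h3, h4⟩
  · rintro ⟨v, hx, f, h1, h2, h3, h4⟩
    exact ⟨_, v, hx, f, h1, h2, h3, h4⟩

/-- Whether a vertex is covered depends only on the edges into vertices of at most its rank. -/
theorem Covered.congr {H : Lift 𝔹 n0} {tag : (Σ b, Fin (n b)) → Option H.V}
    {ξ ξ' : Edge (fcGraph B n) → Bool × Bool} {r : VB → ℕ} (hr : ∀ a b, B.Adj a b → r a < r b)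
    {k : ℕ} (h : ∀ e : Edge (fcGraph B n), r e.1.2.1 < k → ξ e = ξ' e) {x : Σ b, Fin (n b)}
    (hx : Covered H tag ξ x) (hk : r x.1 < k) : Covered H tag ξ' x := by
  induction hx with
  | mk x v hx f htag hf hgood hall ih =>
    refine ⟨_, v, hx, f, htag, fun u => ih u ?_, fun u => ?_, fun y hy h1 => ?_⟩
    · obtain ⟨ha, -⟩ := hgood u
      exact (hr _ _ ha).trans hk
    · obtain ⟨ha, h2⟩ := hgood u
      exact ⟨ha, by rw [← h ⟨(f u, x), ha⟩ hk]; exact h2⟩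
    · exact hall y hy (by rw [h ⟨(y, x), hy⟩ hk]; exact h1)

/-- Locality of matching: only the edges into `x` are inspected, which is what makes matches at
distinct vertices independent once `s` is frozen. -/
theorem IsMatch.congr {H : Lift 𝔹 n0} {tag : (Σ b, Fin (n b)) → Option H.V}
    {s s' : (Σ b, Fin (n b)) → Prop} {ξ ξ' : Edge (fcGraph B n) → Bool × Bool}
    {x : Σ b, Fin (n b)}
    (hs : ∀ y, (fcGraph B n).Adj y x → s y → s' y)
    (h : ∀ e : Edge (fcGraph B n), e.1.2 = x → ξ e = ξ' e)
    (hx : IsMatch H tag s ξ x) : IsMatch H tag s' ξ' x := by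
  obtain ⟨v, hx, f, htag, hf, hgood, hall⟩ := hx
  refine ⟨v, hx, f, htag, fun u => ?_, fun u => ?_, fun y hy h1 => ?_⟩
  · obtain ⟨ha, -⟩ := hgood u
    exact hs _ ha (hf u)
  · obtain ⟨ha, h2⟩ := hgood u
    exact ⟨ha, by rw [← h ⟨(f u, x), ha⟩ rfl]; exact h2⟩
  · exact hall y hy (by rw [h ⟨(y, x), hy⟩ rfl]; exact h1)

theorem width_sparseLift [Fintype VB] (hn : ∀ b : 𝔹.I, n b = n0 b)
    (m : Edge (fcGraph B n) → Bool) (b : VB) : (sparseLift hn m).width b = n b := by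
  have h : (sparseLift hn m).π ⁻¹' {b} = 
      Set.range (fun i : Fin (n b) => (⟨b, i⟩ : Σ b, Fin (n b))) := by
    ext ⟨a, i⟩
    constructor
    · rintro rfl
      exact ⟨i, rfl⟩
    · rintro ⟨j, hj⟩
      exact (congrArg Sigma.fst hj).symm
  rw [Lift.width, h]
  have := Set.ncard_image_of_injective Set.univ (f := fun i : Fin (n b) =>
    (⟨b, i⟩ : Σ b, Fin (n b))) 
    (fun i j h => by simpa using h)
  rw [← Set.image_univ]
  exact this.trans (by simp)

/-- The covered vertices that no bad edge reaches carry a cover. -/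
theorem hasCover_of_card [Fintype VB] (hn : ∀ b : 𝔹.I, n b = n0 b) (H : Lift 𝔹 n0) (wH : Param H)
    (tag : (Σ b, Fin (n b)) → Option H.V) (htype : ∀ x v, tag x = some v → H.π v = x.1)
    (hinput : ∀ x v, tag x = some v → ∀ (hv : H.π v ∈ 𝔹.I) (hx : x.1 ∈ 𝔹.I),
      H.c ⟨v, hv⟩ = ⟨⟨x.1, hx⟩, Fin.cast (hn ⟨x.1, hx⟩) x.2⟩)
    (ξ : Edge (fcGraph B n) → Bool × Bool) (w0 : ∀ e : Edge (fcGraph B n), 𝔹.W (fcType e)) (η : ℝ)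
    (hξ : ∀ e, (ξ e).2 = true → ∃ u v, tag e.1.1 = some u ∧ tag e.1.2 = some v ∧
      ∃ (h : H.graph.Adj u v) (he : H.edgeType ⟨(u, v), h⟩ = fcType e),
        ‖w0 e - castW 𝔹 he (wH ⟨(u, v), h⟩)‖ ≤ η / 2)
    (m : Edge (fcGraph B n) → Bool) (hm : ∀ e, (ξ e).1 = m e)
    (w : Param (sparseLift hn m)) (bad : Edge (sparseLift hn m).graph → Prop)
    (hbad : ∀ e, ¬ bad e → ‖w e - restrictParam hn m w0 e‖ ≤ η / 2) (α : H.V → ℝ)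
    (hα : ∀ v, α v * n (H.π v) ≤ ({x | Covered H tag ξ x ∧ tag x = some v ∧
      ¬ Affected (sparseLift hn m).graph bad x} : Set (Σ b, Fin (n b))).ncard) :
    HasCover w wH α η := by
  let G := sparseLift hn m
  let verts : Set G.V := {x | Covered H tag ξ x ∧ ¬ Affected G.graph bad x}
  let S : Subgraph G.graph := ⟨verts, ⟨fun x y => G.graph.Adj x.1 y.1⟩, fun _ _ h => h⟩
  have htagS : ∀ x : S.verts, ∃ v, tag x.1 = some v := fun x => by
    obtain ⟨v, hv, -⟩ := covered_iff.1 x.2.1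
    exact ⟨v, hv⟩
  choose φ hφ using htagS
  have hgood : ∀ (x y : S.verts) (h : G.graph.Adj x.1 y.1),
      ξ ⟨(x.1, y.1), h.1⟩ = (true, true) := fun x y h => by
    obtain ⟨v, hv, f, h1, h2, h3, h4⟩ := covered_iff.1 y.2.1
    obtain ⟨u, hu⟩ := h4 x.1 h.1 ((hm _).trans h.2)
    obtain ⟨h5, h6⟩ := h3 u
    simp only [hu] at h6
    exact h6
  have hhom : IsHom S.graph H.graph φ := fun x y h => by
    obtain ⟨u, v, hu, hv, hadj, -⟩ := hξ ⟨(x.1, y.1), h.1⟩ (by rw [hgood x y h])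
    rw [hφ] at hu hv
    obtain rfl := Option.some_injective _ hu
    obtain rfl := Option.some_injective _ hv
    exact hadj
  -- Being affected propagates along edges, so its negation passes to parents; this makes the
  -- inclusion of `S` a fibration.
  have hpar : ∀ (x : G.V) (y : S.verts), G.graph.Adj x y.1 → x ∈ S.verts := fun x y h => by
    obtain ⟨v, hv, f, h1, h2, h3, h4⟩ := covered_iff.1 y.2.1
    obtain ⟨u, rfl⟩ := h4 x h.1 ((hm _).trans h.2)
    exact ⟨h2 u, fun H' => y.2.2 (Affected.step ⟨(f u, y.1), h⟩ H')⟩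
  have hfib : IsFibration S.graph H.graph φ := by
    refine ⟨hhom, fun y => ⟨fun x hx => hhom x y hx, fun x hx x' hx' hxx => ?_, fun u hu => ?_⟩⟩
    · obtain ⟨v, hv, f, h1, h2, h3, h4⟩ := covered_iff.1 y.2.1
      obtain ⟨u, hu⟩ := h4 x.1 hx.1 ((hm _).trans hx.2)
      obtain ⟨u', hu'⟩ := h4 x'.1 hx'.1 ((hm _).trans hx'.2)
      have e1 := h1 u
      have e2 := h1 u'
      rw [hu, hφ] at e1
      rw [hu', hφ] at e2
      -- Parents of `y` in `S` are values of `f`, and `f` is a section of the tag, so equal tags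
      -- force equal parents.
      have : u = u' := Subtype.ext (by
        rw [← Option.some_injective _ e1, ← Option.some_injective _ e2]; exact hxx)
      subst this
      exact Subtype.ext (hu.symm.trans hu')
    · obtain ⟨v, hv, f, h1, h2, h3, h4⟩ := covered_iff.1 y.2.1
      rw [hφ] at hv
      obtain rfl := Option.some_injective _ hv
      obtain ⟨ha, h5⟩ := h3 ⟨u, hu⟩
      have hadj : G.graph.Adj (f ⟨u, hu⟩) y.1 := ⟨ha, by rw [← hm, h5]⟩
      refine ⟨⟨f ⟨u, hu⟩, hpar _ y hadj⟩, hadj, ?_⟩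
      have := h1 ⟨u, hu⟩
      have h6 := hφ ⟨f ⟨u, hu⟩, hpar _ y hadj⟩
      exact Option.some_injective _ (h6.symm.trans this)
  let F : PartialMorphism G H :=
    { S := S
      φ := φ
      incl :=
        { fibration := ⟨S.incl, fun y => ⟨fun x hx => hx, Subtype.val_injective.injOn,
            fun x hx => ⟨⟨x, hpar x y hx⟩, hx, rfl⟩⟩⟩
          type_eq := fun _ => rfl
          input_eq := fun _ _ _ => rfl }
      morphism :=
        { fibration := hfib
          type_eq := fun x => htype _ _ (hφ x)
          input_eq := fun x hx hx' => hinput _ _ (hφ x) hx' hx } }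
  refine ⟨F, ⟨fun e => ?_, fun v => ?_⟩⟩
  -- A bad edge affects its own head, so no edge of `S` is bad; the error is then `η / 2` from the
  -- perturbation plus `η / 2` from the initial weights.
  · have hnb : ¬ bad (mapEdge S.incl e) := fun hb => e.1.2.2.2 (Affected.head _ hb)
    have h1 := hbad _ hnb
    obtain ⟨u, v, hu, hv, hadj, he, h2⟩ :=
      hξ ⟨(e.1.1.1, e.1.2.1), e.2.1⟩ (by rw [hgood _ _ e.2])
    rw [hφ] at hu hv
    obtain rfl := Option.some_injective _ hu
    obtain rfl := Option.some_injective _ hv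
    refine (norm_sub_le_norm_sub_add_norm_sub _ (restrictParam hn m w0 (mapEdge S.incl e))
      _).trans ?_
    have h3 : ‖restrictParam hn m w0 (mapEdge S.incl e) -
      castW 𝔹 (F.edgeType_eq e) (wH (mapEdge F.morphism.fibration.hom e))‖ ≤ η / 2 := h2
    linarith
  · rw [width_sparseLift]
    refine (hα v).trans (Nat.cast_le.2 ?_)
    rw [← Set.ncard_image_of_injective _ (Subtype.val_injective (p := (· ∈ S.verts)))]
    refine Set.ncard_le_ncard ?_ (Set.toFinite _)
    rintro x ⟨h1, h2, h3⟩
    refine ⟨⟨x, h1, h3⟩, ?_, rfl⟩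
    exact Option.some_injective _ ((hφ ⟨x, h1, h3⟩).symm.trans h2)

open scoped Classical in
/-- Bound on the number of affected vertices when the out-degrees are controlled. -/
theorem card_affected_le [Fintype VB] {r : VB → ℕ} (hr : ∀ a b, B.Adj a b → r a < r b)
    (m : Edge (fcGraph B n) → Bool) (bad : Edge (sparseGraph m) → Prop)
    (L : Edge B → ℝ) (hL : ∀ e, 0 ≤ L e)
    (hdeg : ∀ (e : Edge B) (i : Fin (n e.1.1)),
      ((Finset.univ.filter fun j : Fin (n e.1.2) =>
        m ⟨(⟨e.1.1, i⟩, ⟨e.1.2, j⟩), e.2⟩ = true).card : ℝ) ≤ L e * (n e.1.2 / n e.1.1))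
    (q : ℝ) (hq : 0 ≤ q)
    (hbad : ∀ b, (∃ a, B.Adj a b) → ((Finset.univ.filter bad).card : ℝ) ≤ q * n b) (b : VB) :
    ((Finset.univ.filter fun i : Fin (n b) => Affected (sparseGraph m) bad ⟨b, i⟩).card : ℝ) ≤
      q * (1 + ∑ e, L e) ^ r b * n b := by
  set Λ := ∑ e, L e with hΛ
  have hΛ0 : 0 ≤ Λ := Finset.sum_nonneg fun e _ => hL e
  let D : ∀ b, Finset (Fin (n b)) := fun b =>
    Finset.univ.filter fun i : Fin (n b) => Affected (sparseGraph m) bad ⟨b, i⟩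
  change ((D b).card : ℝ) ≤ _
  induction hk : r b using Nat.strong_induction_on generalizing b with
  | _ k ih =>
  by_cases hpar : ∃ a, B.Adj a b
  · have hk0 : 1 ≤ k := by
      obtain ⟨a, ha⟩ := hpar
      have := hr a b ha
      omega
    let par : Finset {a // B.Adj a b} := Finset.univ
    let child : (a : {a // B.Adj a b}) → Fin (n a) → Finset (Fin (n b)) := fun a i =>
      Finset.univ.filter fun j : Fin (n b) => m ⟨(⟨a, i⟩, ⟨b, j⟩), a.2⟩ = true
    -- An affected vertex is the head of a bad edge or a child of an affected vertex of a parent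
    -- type.
    have hsub : (D b).map ⟨Sigma.mk b, sigma_mk_injective⟩ ⊆
        (Finset.univ.filter bad).image (fun e => e.1.2) ∪
        (par.biUnion fun a => (D a).biUnion fun i => child a i).map
          ⟨Sigma.mk b, sigma_mk_injective⟩ := by
      intro x hx
      simp only [Finset.mem_map, Function.Embedding.coeFn_mk] at hx
      obtain ⟨j, hj, rfl⟩ := hx
      simp only [D, Finset.mem_filter, Finset.mem_univ, true_and] at hj
      generalize hy : (⟨b, j⟩ : Σ b, Fin (n b)) = y at hj
      rw [Finset.mem_union]
      cases hj with
      | head e he =>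
        left
        exact Finset.mem_image.2 ⟨e, by simpa using he, rfl⟩
      | step e he =>
        right
        obtain ⟨⟨⟨a, i⟩, z⟩, h1, h2⟩ := e
        dsimp only at hy he h1 h2 ⊢
        subst hy
        simp only [Finset.mem_map, Finset.mem_biUnion, Function.Embedding.coeFn_mk]
        exact ⟨j, ⟨⟨a, h1⟩, Finset.mem_univ _, i, by simpa [D] using he, by simpa [child] using h2⟩,
          rfl⟩
    have h1 : (D b).card ≤ (Finset.univ.filter bad).card + ∑ a ∈ par, ∑ i ∈ D a, (child a i).card := by
      rw [← Finset.card_map]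
      refine (Finset.card_le_card hsub).trans ((Finset.card_union_le _ _).trans ?_)
      refine add_le_add Finset.card_image_le ?_
      rw [Finset.card_map]
      refine Finset.card_biUnion_le.trans (Finset.sum_le_sum fun a _ => ?_)
      exact Finset.card_biUnion_le
    have h2 : ((D b).card : ℝ) ≤ (Finset.univ.filter bad).card +
        ∑ a ∈ par, ∑ i ∈ D a, ((child a i).card : ℝ) := by exact_mod_cast h1
    have h3 : ∀ a ∈ par, ∑ i ∈ D a, ((child a i).card : ℝ) ≤
        q * (1 + Λ) ^ (k - 1) * n b * L ⟨(a.1, b), a.2⟩ := fun a _ => by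
      have hra := hr _ _ a.2
      calc ∑ i ∈ D a, ((child a i).card : ℝ)
          ≤ ∑ i ∈ D a, L ⟨(a.1, b), a.2⟩ * (n b / n a.1) :=
            Finset.sum_le_sum fun i _ => hdeg ⟨(a.1, b), a.2⟩ i
        _ = (D a).card * (L ⟨(a.1, b), a.2⟩ * (n b / n a.1)) := by simp
        _ ≤ (q * (1 + Λ) ^ r a * n a.1) * (L ⟨(a.1, b), a.2⟩ * (n b / n a.1)) := by
            refine mul_le_mul_of_nonneg_right (ih (r a) (by omega) a.1 rfl) ?_
            exact mul_nonneg (hL _) (by positivity)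
        _ = q * (1 + Λ) ^ r a * n b * L ⟨(a.1, b), a.2⟩ * (n a.1 / n a.1) := by ring
        -- If `n a = 0` the quotient `n a / n a` is 0, so only the bound by 1 is available.
        _ ≤ q * (1 + Λ) ^ r a * n b * L ⟨(a.1, b), a.2⟩ * 1 := by
            refine mul_le_mul_of_nonneg_left (div_self_le_one _) ?_
            have := hL ⟨(a.1, b), a.2⟩
            positivity
        _ ≤ q * (1 + Λ) ^ (k - 1) * n b * L ⟨(a.1, b), a.2⟩ := by
            rw [mul_one]
            have := hL ⟨(a.1, b), a.2⟩
            gcongr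
            · linarith
            · omega
    have h4 : ∑ a ∈ par, L ⟨(a.1, b), a.2⟩ ≤ Λ := by
      let g : {a // B.Adj a b} ↪ Edge B := ⟨fun a => ⟨(a.1, b), a.2⟩, fun a a' h => by
        have := congrArg (fun e : Edge B => e.1.1) h
        exact Subtype.ext this⟩
      have := Finset.sum_map par g L
      change ∑ a ∈ par, L (g a) ≤ _
      rw [← this]
      exact Finset.sum_le_sum_of_subset_of_nonneg (Finset.subset_univ _) fun e _ _ => hL e
    have h5 := hbad b hpar
    have h6 : (1 : ℝ) ≤ (1 + Λ) ^ (k - 1) := one_le_pow₀ (by linarith)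
    have h7 : q * n b ≤ q * (1 + Λ) ^ (k - 1) * n b := by
      have : 0 ≤ q * n b := by positivity
      nlinarith
    have h8 := Finset.sum_le_sum h3
    rw [← Finset.mul_sum] at h8
    have h9 : q * (1 + Λ) ^ (k - 1) * n b * ∑ a ∈ par, L ⟨(a.1, b), a.2⟩ ≤
        q * (1 + Λ) ^ (k - 1) * n b * Λ := mul_le_mul_of_nonneg_left h4 (by positivity)
    -- In the last factor `1 + Λ`, the 1 pays for heads of bad edges and `Λ` for children of
    -- affected vertices.
    have h10 : (1 + Λ) ^ k = (1 + Λ) ^ (k - 1) * (1 + Λ) := by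
      rw [← pow_succ, Nat.sub_add_cancel hk0]
    rw [h10]
    nlinarith
  · have : D b = ∅ := by
      refine Finset.eq_empty_of_forall_notMem fun j hj => hpar ?_
      simp only [D, Finset.mem_filter, Finset.mem_univ, true_and] at hj
      generalize hy : (⟨b, j⟩ : Σ b, Fin (n b)) = y at hj
      cases hj with
      | head e he => exact ⟨e.1.1.1, by have := e.2.1; rw [← hy] at this; exact this⟩
      | step e he => exact ⟨e.1.1.1, by have := e.2.1; rw [← hy] at this; exact this⟩
    rw [this]
    simp only [Finset.card_empty, Nat.cast_zero]
    positivity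

end Deterministic

/-! ### Probability of a match, and conditioning on lower ranks. -/

section MatchProbability

universe u v

variable {VB : Type u} {B : Digraph VB} {𝔹 : PMod.{u, v} B} {n0 : 𝔹.I → ℕ} {n : VB → ℕ}
  {Ω : Type*} [MeasurableSpace Ω] {P : Measure Ω}

open scoped Classical in
/-- Lower bound on the probability that a vertex matches its tag. -/
theorem prod_le_measureReal_isMatch [Fintype VB] [IsProbabilityMeasure P] {H : Lift 𝔹 n0}
    {tag : (Σ b, Fin (n b)) → Option H.V} (htype : ∀ x v, tag x = some v → H.π v = x.1)
    {ξ : Edge (fcGraph B n) → Ω → Bool × Bool} (hξ : ∀ e, Measurable (ξ e)) (hind : iIndepFun ξ P)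
    {x : Σ b, Fin (n b)} {v : H.V} (hx : tag x = some v) (s : (Σ b, Fin (n b)) → Prop)
    (ρ : parents H.graph v → ℝ) (hρ0 : ∀ u, 0 ≤ ρ u)
    (hρ : ∀ u y, tag y = some u.1 → ∀ h : (fcGraph B n).Adj y x,
      ρ u ≤ P.real {ω | ξ ⟨(y, x), h⟩ ω = (true, true)}) :
    (∏ u : parents H.graph v,
        (((Finset.univ.filter fun y => tag y = some u.1 ∧ s y).card : ℝ) * ρ u)) *
      (∏ y : {y // (fcGraph B n).Adj y x}, P.real {ω | (ξ ⟨(y.1, x), y.2⟩ ω).1 = false}) ≤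
      P.real {ω | IsMatch H tag s (fun e => ξ e ω) x} := by
  set F : parents H.graph v → Finset (Σ b, Fin (n b)) := fun u =>
    Finset.univ.filter fun y => tag y = some u.1 ∧ s y with hF
  set In := {y // (fcGraph B n).Adj y x}
  set Q : ℝ := ∏ y : In, P.real {ω | (ξ ⟨(y.1, x), y.2⟩ ω).1 = false} with hQ
  let X : In → Ω → Bool × Bool := fun y => ξ ⟨(y.1, x), y.2⟩
  have hX : ∀ y, Measurable (X y) := fun y => hξ _
  have hXind : iIndepFun X P := hind.precomp (g := fun y : In => (⟨(y.1, x), y.2⟩ : Edge (fcGraph B n)))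
    fun y y' h => Subtype.ext (congrArg (fun e : Edge (fcGraph B n) => e.1.1) h)
  -- For a choice `f` of one source per parent, `E f` asks that the edges from the values of `f` be
  -- present and good and all other edges into `x` be absent.
  let K : (parents H.graph v → Σ b, Fin (n b)) → In → Set (Bool × Bool) := fun f y =>
    if ∃ u, f u = y.1 then {(true, true)} else {c | c.1 = false}
  let E : (parents H.graph v → Σ b, Fin (n b)) → Set Ω := fun f => ⋂ y, X y ⁻¹' K f y
  have hadj : ∀ f ∈ Fintype.piFinset F, ∀ u, (fcGraph B n).Adj (f u) x := fun f hf u => by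
    have h1 := Fintype.mem_piFinset.1 hf u
    simp only [hF, Finset.mem_filter, Finset.mem_univ, true_and] at h1
    change B.Adj (f u).1 x.1
    rw [← htype _ _ h1.1, ← htype _ _ hx]
    exact H.hom _ _ u.2
  have htagf : ∀ f ∈ Fintype.piFinset F, ∀ u, tag (f u) = some u.1 ∧ s (f u) := fun f hf u => by
    simpa [hF] using Fintype.mem_piFinset.1 hf u
  have hEmeas : ∀ f, MeasurableSet (E f) := fun f =>
    MeasurableSet.iInter fun y => hX y (MeasurableSet.of_discrete)
  have hsub : (⋃ f ∈ Fintype.piFinset F, E f) ⊆ {ω | IsMatch H tag s (fun e => ξ e ω) x} := by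
    intro ω hω
    simp only [Set.mem_iUnion, exists_prop] at hω
    obtain ⟨f, hf, hω⟩ := hω
    have hω' : ∀ y : In, ξ ⟨(y.1, x), y.2⟩ ω ∈ K f y := fun y => Set.mem_iInter.1 hω y
    refine ⟨v, hx, f, fun u => (htagf f hf u).1, fun u => (htagf f hf u).2, fun u => ?_,
      fun y hy h1 => ?_⟩
    · refine ⟨hadj f hf u, ?_⟩
      have := hω' ⟨f u, hadj f hf u⟩
      simp only [K] at this
      rw [if_pos ⟨u, rfl⟩] at this
      exact this
    · by_contra hcon
      have := hω' ⟨y, hy⟩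
      simp only [K] at this
      rw [if_neg hcon] at this
      have h2 : (ξ ⟨(y, x), hy⟩ ω).1 = false := this
      rw [h2] at h1
      exact absurd h1 (by simp)
  -- If `f` and `f'` differ at `u`, then `f u` is not a value of `f'`, since its tag could only
  -- place it at `u`. The edge from `f u` is thus present in one event and absent in the other.
  have hdisj : Set.PairwiseDisjoint (↑(Fintype.piFinset F)) E := by
    intro f hf f' hf' hne
    obtain ⟨u, hu⟩ := Function.ne_iff.1 hne
    refine Set.disjoint_left.2 fun ω h1 h2 => ?_
    have h1' := Set.mem_iInter.1 h1 ⟨f u, hadj f hf u⟩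
    have h2' := Set.mem_iInter.1 h2 ⟨f u, hadj f hf u⟩
    simp only [K] at h1' h2'
    rw [if_pos ⟨u, rfl⟩] at h1'
    rw [if_neg] at h2'
    · have h3 : X ⟨f u, hadj f hf u⟩ ω = (true, true) := h1'
      have h4 : (X ⟨f u, hadj f hf u⟩ ω).1 = false := h2'
      rw [h3] at h4
      exact absurd h4 (by simp)
    · rintro ⟨u', hu'⟩
      have e1 := (htagf f' hf' u').1
      rw [hu', (htagf f hf u).1] at e1
      have : u = u' := Subtype.ext (Option.some_injective _ e1)
      subst this
      exact hu hu'.symm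
  have hE : ∀ f ∈ Fintype.piFinset F, (∏ u, ρ u) * Q ≤ P.real (E f) := by
    intro f hf
    have h1 : P.real (E f) = ∏ y : In, P.real (X y ⁻¹' K f y) := by
      rw [measureReal_def, hXind.meas_iInter (s := fun y => X y ⁻¹' K f y)
        (fun y => ⟨K f y, MeasurableSet.of_discrete, rfl⟩), ENNReal.toReal_prod]
      rfl
    let g : parents H.graph v ↪ In := ⟨fun u => ⟨f u, hadj f hf u⟩, fun u u' h => by
      have h2 : f u = f u' := congrArg Subtype.val h
      have e1 := (htagf f hf u).1
      rw [h2, (htagf f hf u').1] at e1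
      exact (Subtype.ext (Option.some_injective _ e1)).symm⟩
    rw [h1, hQ, ← Finset.prod_mul_prod_compl (Finset.univ.map g) (fun y => P.real (X y ⁻¹' K f y)),
      ← Finset.prod_mul_prod_compl (Finset.univ.map g)
        (fun y : In => P.real {ω | (ξ ⟨(y.1, x), y.2⟩ ω).1 = false}), ← mul_assoc]
    refine mul_le_mul ?_ ?_ (Finset.prod_nonneg fun _ _ => measureReal_nonneg)
      (Finset.prod_nonneg fun _ _ => measureReal_nonneg)
    -- `Q` runs over all in-edges, including those in the range of `f`; these superfluous factors
    -- are probabilities and can be bounded by 1.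
    · refine (mul_le_of_le_one_right (Finset.prod_nonneg fun u _ => hρ0 u)
        (Finset.prod_le_one (fun _ _ => measureReal_nonneg) fun _ _ => measureReal_le_one)).trans ?_
      rw [Finset.prod_map]
      refine Finset.prod_le_prod (fun u _ => hρ0 u) fun u _ => ?_
      have h2 : K f (g u) = {(true, true)} := if_pos ⟨u, rfl⟩
      rw [h2]
      exact hρ u (f u) (htagf f hf u).1 (hadj f hf u)
    · refine Finset.prod_le_prod (fun _ _ => measureReal_nonneg) fun y hy => ?_
      have h2 : K f y = {c | c.1 = false} := if_neg fun ⟨u, hu⟩ => by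
        refine (Finset.mem_compl.1 hy) (Finset.mem_map.2 ⟨u, Finset.mem_univ _, Subtype.ext hu⟩)
      rw [h2]
      exact le_rfl
  calc (∏ u, (((F u).card : ℝ) * ρ u)) * Q
      = ∑ f ∈ Fintype.piFinset F, (∏ u, ρ u) * Q := by
        rw [Finset.sum_const, Fintype.card_piFinset, nsmul_eq_mul, Finset.prod_mul_distrib]
        push_cast
        ring
    _ ≤ ∑ f ∈ Fintype.piFinset F, P.real (E f) := Finset.sum_le_sum hE
    _ = P.real (⋃ f ∈ Fintype.piFinset F, E f) :=
        (measureReal_biUnion_finset hdisj fun f _ => hEmeas f).symm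
    _ ≤ _ := measureReal_mono hsub (measure_ne_top _ _)

open scoped Classical in
/-- Lower tail of the number of vertices with a given tag that match it. -/
theorem measureReal_card_isMatch_le [Fintype VB] [IsProbabilityMeasure P] {H : Lift 𝔹 n0}
    {tag : (Σ b, Fin (n b)) → Option H.V}
    {ξ : Edge (fcGraph B n) → Ω → Bool × Bool} (hξ : ∀ e, Measurable (ξ e)) (hind : iIndepFun ξ P)
    (v : H.V) (s : (Σ b, Fin (n b)) → Prop) (p T : ℝ)
    (hp : ∀ x, tag x = some v → p ≤ P.real {ω | IsMatch H tag s (fun e => ξ e ω) x}) :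
    P.real {ω | ((Finset.univ.filter fun x =>
        tag x = some v ∧ IsMatch H tag s (fun e => ξ e ω) x).card : ℝ) ≤ T} ≤
      Real.exp (T - (1 - Real.exp (-1)) *
        ((Finset.univ.filter fun x => tag x = some v).card * p)) := by
  let J := {x // tag x = some v}
  let Y : J → Ω → Bool := fun x ω => decide (IsMatch H tag s (fun e => ξ e ω) x.1)
  have hYind : iIndepFun Y P := by
    -- Edges are grouped by their head: each match is a function of one block, and the blocks are
    -- independent.
    have h1 := (iIndepFun.fiberwise hξ hind (fun e : Edge (fcGraph B n) => e.1.2)).precomp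
      (g := fun x : J => x.1) Subtype.val_injective
    have h2 := h1.comp (fun (x : J) (c : {e : Edge (fcGraph B n) // e.1.2 = x.1} → Bool × Bool) =>
      decide (IsMatch H tag s (fun e => if he : e.1.2 = x.1 then c ⟨e, he⟩ else (true, true)) x.1))
      (fun x => .of_discrete)
    convert h2 using 1
    ext x ω
    simp only [Y, Function.comp]
    congr 1
    refine propext ⟨IsMatch.congr (fun _ _ h => h) fun e he => ?_,
      IsMatch.congr (fun _ _ h => h) fun e he => ?_⟩ <;> rw [dif_pos he]
  have hY : ∀ x, Measurable (Y x) := fun x => by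
    have : Measurable fun c : Edge (fcGraph B n) → Bool × Bool =>
      decide (IsMatch H tag s c x.1) := .of_discrete
    exact this.comp (measurable_pi_lambda _ hξ)
  have h3 := count_lower_tail hY hYind T
  have h4 : ∀ ω, ∑ x, (if Y x ω = true then (1 : ℝ) else 0) = ((Finset.univ.filter fun x =>
        tag x = some v ∧ IsMatch H tag s (fun e => ξ e ω) x).card : ℝ) := fun ω => by
    rw [Finset.sum_boole, ← Finset.card_map (Function.Embedding.subtype fun x => tag x = some v)]
    congr 2
    ext x
    simp [Y, J, and_comm]
  simp_rw [h4] at h3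
  refine h3.trans (Real.exp_le_exp.2 ?_)
  have h5 : (Finset.univ.filter fun x => tag x = some v).card * p ≤
      ∑ x : J, P.real {ω | Y x ω = true} := by
    have : ∑ x : J, p = (Finset.univ.filter fun x => tag x = some v).card * p := by
      rw [Finset.sum_const, nsmul_eq_mul, Finset.card_univ, Fintype.card_subtype]
    rw [← this]
    refine Finset.sum_le_sum fun x _ => ?_
    simpa [Y] using hp x.1 x.2
  have h6 : Real.exp (-1) ≤ 1 := Real.exp_le_one_iff.2 (by norm_num)
  nlinarith [mul_le_mul_of_nonneg_left h5 (sub_nonneg.2 h6)]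

open scoped Classical in
/-- The number of covered vertices over `v`. -/
noncomputable def coverCard [Fintype VB] (H : Lift 𝔹 n0) (tag : (Σ b, Fin (n b)) → Option H.V)
    (ξ : Edge (fcGraph B n) → Bool × Bool) (v : H.V) : ℕ :=
  (Finset.univ.filter fun x => tag x = some v ∧ Covered H tag ξ x).card

open scoped Classical in
/-- A bound on the lower tail of the number of matching vertices, uniform in the possible states of
the lower levels, bounds the probability that `v` is the first vertex with few covered vertices. -/
theorem measureReal_first_failure_le [Fintype VB] [IsProbabilityMeasure P] {H : Lift 𝔹 n0}
    {tag : (Σ b, Fin (n b)) → Option H.V} (htype : ∀ x v, tag x = some v → H.π v = x.1)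
    {ξ : Edge (fcGraph B n) → Ω → Bool × Bool} (hξ : ∀ e, Measurable (ξ e)) (hind : iIndepFun ξ P)
    {r : VB → ℕ} (hr : ∀ a b, B.Adj a b → r a < r b) (v : H.V) (t : H.V → ℝ) {ε : ℝ} (hε : 0 ≤ ε)
    (hle : ∀ s : (Σ b, Fin (n b)) → Prop,
      (∀ u, r (H.π u) < r (H.π v) →
        t u ≤ (Finset.univ.filter fun y => tag y = some u ∧ s y).card) →
      P.real {ω | ((Finset.univ.filter fun x =>
        tag x = some v ∧ IsMatch H tag s (fun e => ξ e ω) x).card : ℝ) < t v} ≤ ε) :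
    P.real {ω | (∀ u, r (H.π u) < r (H.π v) → t u ≤ coverCard H tag (fun e => ξ e ω) u) ∧
      (coverCard H tag (fun e => ξ e ω) v : ℝ) < t v} ≤ ε := by
  let k := r (H.π v)
  -- Edges are split by the rank of their head: `lo` determines the covered vertices of rank below
  -- `k`, `hi` the matches at rank `k`.
  let lo : Finset (Edge (fcGraph B n)) := Finset.univ.filter fun e => r e.1.2.1 < k
  let hi : Finset (Edge (fcGraph B n)) := Finset.univ.filter fun e => r e.1.2.1 = k
  have hdisj : Disjoint lo hi := Finset.disjoint_filter.2 fun e _ h1 h2 => by omega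
  have hLH := hind.indepFun_finset lo hi hdisj hξ
  -- The value `(true, true)` outside `S` is arbitrary; it is never read where `ext` is used.
  let ext : ∀ S : Finset (Edge (fcGraph B n)), (S → Bool × Bool) → Edge (fcGraph B n) → Bool × Bool :=
    fun S c e => if he : e ∈ S then c ⟨e, he⟩ else (true, true)
  let Φ : (lo → Bool × Bool) → (Σ b, Fin (n b)) → Bool := fun c y =>
    decide (r y.1 < k ∧ Covered H tag (ext lo c) y)
  have hX : ∀ ω y, Φ (fun e : lo => ξ e ω) y = true ↔
      r y.1 < k ∧ Covered H tag (fun e => ξ e ω) y := fun ω y => by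
    simp only [Φ, decide_eq_true_eq]
    have h1 : ∀ e : Edge (fcGraph B n), r e.1.2.1 < k → ext lo (fun e : lo => ξ e ω) e = ξ e ω :=
      fun e he => dif_pos (by simpa [lo] using he)
    exact and_congr_right fun hy =>
      ⟨fun h => h.congr hr h1 hy, fun h => h.congr hr (fun e he => (h1 e he).symm) hy⟩
  have hind' : IndepFun (Φ ∘ fun ω (e : lo) => ξ e ω) (fun ω (e : hi) => ξ e ω) P :=
    hLH.comp (φ := Φ) (ψ := id) .of_discrete measurable_id
  have hΦm : Measurable (Φ ∘ fun ω (e : lo) => ξ e ω) :=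
    Measurable.comp .of_discrete (measurable_pi_lambda _ fun e => hξ e)
  have hmatch : ∀ (s : (Σ b, Fin (n b)) → Prop) (ω x), tag x = some v →
      (IsMatch H tag s (ext hi fun e : hi => ξ e ω) x ↔ IsMatch H tag s (fun e => ξ e ω) x) :=
    fun s ω x hx => by
      have h1 : ∀ e : Edge (fcGraph B n), e.1.2 = x → ext hi (fun e : hi => ξ e ω) e = ξ e ω :=
        fun e he => dif_pos (by simp [hi, k, he, htype _ _ hx])
      exact ⟨IsMatch.congr (fun _ _ h => h) h1,
        IsMatch.congr (fun _ _ h => h) fun e he => (h1 e he).symm⟩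
  have key := IndepFun.measureReal_le_of_forall hΦm hind'
    {s | ∀ u, r (H.π u) < k → t u ≤ (Finset.univ.filter fun y => tag y = some u ∧ s y = true).card}
    (fun s => {c | ((Finset.univ.filter fun x => tag x = some v ∧
      IsMatch H tag (fun y => s y = true) (ext hi c) x).card : ℝ) < t v})
    (fun s => .of_discrete) hε (fun s hs => by
      rw [Set.mem_ofPred_eq] at hs
      refine le_trans (le_of_eq ?_) (hle (fun y => s y = true) fun u hu => by
        convert hs u hu)
      congr 1
      ext ω
      simp only [Set.mem_ofPred_eq]
      rw [Finset.filter_congr fun x _ => and_congr_right fun hx => hmatch _ ω x hx])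
  refine (measureReal_mono (fun ω hω => ?_) (measure_ne_top _ _)).trans key
  obtain ⟨h1, h2⟩ := hω
  refine ⟨fun u hu => ?_, ?_⟩
  · refine (h1 u hu).trans (Nat.cast_le.2 (Finset.card_le_card fun y hy => ?_))
    simp only [Finset.mem_filter, Finset.mem_univ, true_and, Function.comp] at hy ⊢
    refine ⟨hy.1, (hX ω y).2 ⟨?_, hy.2⟩⟩
    rw [← htype _ _ hy.1]
    exact hu
  -- A match against covered vertices of lower rank is itself covered, so few covered vertices means
  -- few matches.
  · refine lt_of_le_of_lt (Nat.cast_le.2 (Finset.card_le_card fun x hx => ?_)) h2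
    simp only [Finset.mem_filter, Finset.mem_univ, true_and, Function.comp] at hx ⊢
    refine ⟨hx.1, covered_iff.2 ?_⟩
    refine IsMatch.congr (fun y _ hy => ?_) (fun _ _ => rfl) ((hmatch _ ω x hx.1).1 hx.2)
    exact ((hX ω y).1 hy).2

end MatchProbability

/-! ### Bounds on the parameter `alpha`. -/

section Alpha

universe u v

variable {VB : Type u} {B : Digraph VB} {𝔹 : PMod.{u, v} B} {n0 : 𝔹.I → ℕ} {n : VB → ℕ}

theorem poissonDensity_pos (k : ℕ) {lam : ℝ} (h : 0 < lam) : 0 < poissonDensity k lam := by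
  unfold poissonDensity
  positivity

/-- The factorial is given away: tags already decide which parent each source represents. -/
theorem poissonDensity_le (k : ℕ) {lam : ℝ} (h : 0 < lam) :
    poissonDensity k lam ≤ Real.exp (-lam) * lam ^ k := by
  unfold poissonDensity
  exact div_le_self (by positivity) (by exact_mod_cast Nat.one_le_iff_ne_zero.2 k.factorial_ne_zero)

theorem poissonDensity_le_one (k : ℕ) {lam : ℝ} (h : 0 < lam) : poissonDensity k lam ≤ 1 := by
  unfold poissonDensity
  rw [mul_div_assoc, Real.exp_neg, inv_mul_le_one₀ (Real.exp_pos _)]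
  exact Real.pow_div_factorial_le_exp _ h.le _

theorem Lift.width_pos (H : Lift 𝔹 n0) (x : H.V) : 0 < H.width (H.π x) :=
  (Set.ncard_pos (Set.toFinite _)).2 ⟨x, rfl⟩

theorem Lift.inputs_pos (H : Lift 𝔹 n0) (x : H.V) (hx : H.π x ∈ 𝔹.I) : 0 < n0 ⟨H.π x, hx⟩ := by
  have h1 : (H.c ⟨x, hx⟩).1 = ⟨H.π x, hx⟩ := Subtype.ext (H.c_type ⟨x, hx⟩)
  rw [← h1]
  exact (H.c ⟨x, hx⟩).2.pos

theorem Lift.two_mul_width_le_normalizer (H : Lift 𝔹 n0) (x : H.V) :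
    2 * (H.width (H.π x) : ℝ) ≤ H.normalizer x := by
  unfold Lift.normalizer
  have h1 : (2 : ℝ) ^ 1 ≤ 2 ^ (1 + (parents B (H.π x)).ncard) :=
    pow_le_pow_right₀ (by norm_num) (by omega)
  have h2 : (0 : ℝ) ≤ H.width (H.π x) := by positivity
  nlinarith

open scoped Classical in
theorem prod_edgeType_eq_prod_pow [Fintype VB] (lam : Edge B → ℝ) (H : Lift 𝔹 n0) (v : H.V) :
    ∏ u : parents H.graph v, lam (H.edgeType ⟨(u.1, v), u.2⟩) =
      ∏ a : parents B (H.π v), lam ⟨(a.1, H.π v), a.2⟩ ^ H.numParents a v := by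
  let g : parents H.graph v → parents B (H.π v) := fun u => ⟨H.π u, H.hom _ _ u.2⟩
  rw [← Finset.prod_fiberwise (s := Finset.univ) (g := g)]
  refine Finset.prod_congr rfl fun a _ => ?_
  rw [Finset.prod_congr rfl (g := fun _ => lam ⟨(a.1, H.π v), a.2⟩), Finset.prod_const]
  · congr 1
    rw [Lift.numParents, ← Set.ncard_coe_finset,
      ← Set.ncard_image_of_injective _ Subtype.val_injective]
    congr 1
    ext y
    simp [g, Subtype.ext_iff, and_comm]
  · intro u hu
    rw [← (Finset.mem_filter.1 hu).2]
    rfl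

variable [Fintype VB] [Acyclic B] {lam : Edge B → ℝ} {N : ∀ e : Edge B, Measure (𝔹.W e)}

theorem alpha_pos_and_le_one (hlam : ∀ e, 0 < lam e) (hN : ∀ e, IsProbabilityMeasure (N e))
    (hN' : ∀ e, (N e).IsOpenPosMeasure) (H : Lift 𝔹 n0) (w : Param H) {η : ℝ} (hη : 0 < η)
    (x : H.V) : 0 < alpha lam N H w η x ∧ alpha lam N H w η x ≤ 1 := by
  classical
  induction x using H.wellFounded.induction with
  | _ x ih =>
  rw [alpha_eq]
  split_ifs with h
  · have h1 : (1 : ℝ) ≤ n0 ⟨H.π x, h⟩ := by exact_mod_cast H.inputs_pos x h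
    exact ⟨by positivity, by rw [div_le_one (by linarith)]; exact h1⟩
  · have hw : (1 : ℝ) ≤ H.width (H.π x) := by exact_mod_cast H.width_pos x
    have hK := H.two_mul_width_le_normalizer x
    have hKpos : 0 < H.normalizer x := by linarith
    have hball : ∀ y : parents H.graph x, 0 < (N (H.edgeType ⟨(y.1, x), y.2⟩)).real
        (Metric.closedBall (w ⟨(y.1, x), y.2⟩) η) := fun y => by
      have := hN' (H.edgeType ⟨(y.1, x), y.2⟩)
      have := hN (H.edgeType ⟨(y.1, x), y.2⟩)
      exact ENNReal.toReal_pos (Metric.measure_closedBall_pos _ _ hη).ne' (measure_ne_top _ _)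
    constructor
    · refine mul_pos (mul_pos (by positivity) ?_) ?_
      · exact Finset.prod_pos fun a _ => poissonDensity_pos _ (hlam _)
      · exact Finset.prod_pos fun y _ => mul_pos (hball y) (ih y.1 y.2).1
    · refine mul_le_one₀ (mul_le_one₀ ?_ ?_ ?_) ?_ ?_
      · rw [div_le_one hKpos]; linarith
      · exact Finset.prod_nonneg fun a _ => (poissonDensity_pos _ (hlam _)).le
      · exact Finset.prod_le_one (fun a _ => (poissonDensity_pos _ (hlam _)).le)
          fun a _ => poissonDensity_le_one _ (hlam _)
      · exact Finset.prod_nonneg fun y _ => (mul_pos (hball y) (ih y.1 y.2).1).le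
      · refine Finset.prod_le_one (fun y _ => (mul_pos (hball y) (ih y.1 y.2).1).le) fun y _ => ?_
        have := hN (H.edgeType ⟨(y.1, x), y.2⟩)
        exact mul_le_one₀ measureReal_le_one (ih y.1 y.2).1.le (ih y.1 y.2).2

/-- Used so that rounding `n b / width b` down costs at most 1 in the expected number of matches. -/
theorem two_mul_width_mul_alpha_le_one (hlam : ∀ e, 0 < lam e)
    (hN : ∀ e, IsProbabilityMeasure (N e)) (hN' : ∀ e, (N e).IsOpenPosMeasure) (H : Lift 𝔹 n0)
    (w : Param H) {η : ℝ} (hη : 0 < η) (v : H.V) (hv : H.π v ∉ 𝔹.I) :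
    2 * H.width (H.π v) * alpha lam N H w η v ≤ 1 := by
  classical
  have hw : (0 : ℝ) < H.width (H.π v) := by exact_mod_cast H.width_pos v
  have hK := H.two_mul_width_le_normalizer v
  have hα := fun y => alpha_pos_and_le_one hlam hN hN' H w hη y
  rw [alpha_eq, dif_neg hv, ← mul_assoc, ← mul_assoc]
  refine mul_le_one₀ (mul_le_one₀ ?_ ?_ ?_) ?_ ?_
  · rw [mul_one_div, div_le_one (by linarith)]; exact hK
  · exact Finset.prod_nonneg fun a _ => (poissonDensity_pos _ (hlam _)).le
  · exact Finset.prod_le_one (fun a _ => (poissonDensity_pos _ (hlam _)).le)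
      fun a _ => poissonDensity_le_one _ (hlam _)
  · exact Finset.prod_nonneg fun y _ => mul_nonneg measureReal_nonneg (hα _).1.le
  · refine Finset.prod_le_one (fun y _ => mul_nonneg measureReal_nonneg (hα _).1.le) fun y _ => ?_
    have := hN (H.edgeType ⟨(y.1, v), y.2⟩)
    exact mul_le_one₀ measureReal_le_one (hα _).1.le (hα _).2

open scoped Classical in
/-- The probability of a match is at least twice the mean proportion prescribed by `alpha`. -/
theorem two_mul_width_mul_alpha_le (hlam : ∀ e, 0 < lam e) (hN : ∀ e, IsProbabilityMeasure (N e))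
    (hN' : ∀ e, (N e).IsOpenPosMeasure) (H : Lift 𝔹 n0) (w : Param H) {η : ℝ} (hη : 0 < η)
    (v : H.V) (hv : H.π v ∉ 𝔹.I) :
    2 * H.width (H.π v) * alpha lam N H w η v ≤
      (∏ u : parents H.graph v, (alpha lam N H w η u.1 * (lam (H.edgeType ⟨(u.1, v), u.2⟩) *
        (N (H.edgeType ⟨(u.1, v), u.2⟩)).real (Metric.closedBall (w ⟨(u.1, v), u.2⟩) η)))) *
      ∏ a : parents B (H.π v), (1 / 2 * Real.exp (-lam ⟨(a.1, H.π v), a.2⟩)) := by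
  have hw : (0 : ℝ) < H.width (H.π v) := by exact_mod_cast H.width_pos v
  rw [alpha_eq, dif_neg hv]
  set p1 := ∏ a : parents B (H.π v), poissonDensity (H.numParents a v) (lam ⟨(a.1, H.π v), a.2⟩)
    with hp1
  set p2 := ∏ y : parents H.graph v, (N (H.edgeType ⟨(y.1, v), y.2⟩)).real
    (Metric.closedBall (w ⟨(y.1, v), y.2⟩) η) * alpha lam N H w η y.1 with hp2
  have hp2' : 0 ≤ p2 := Finset.prod_nonneg fun y _ =>
    mul_nonneg measureReal_nonneg (alpha_pos_and_le_one hlam hN hN' H w hη _).1.le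
  have h1 : p1 ≤ (∏ a : parents B (H.π v), Real.exp (-lam ⟨(a.1, H.π v), a.2⟩)) *
      ∏ u : parents H.graph v, lam (H.edgeType ⟨(u.1, v), u.2⟩) := by
    rw [prod_edgeType_eq_prod_pow, ← Finset.prod_mul_distrib]
    exact Finset.prod_le_prod (fun a _ => (poissonDensity_pos _ (hlam _)).le)
      fun a _ => poissonDensity_le _ (hlam _)
  have hcard : Fintype.card (parents B (H.π v)) = (parents B (H.π v)).ncard := by
    rw [Set.ncard_eq_toFinset_card', Set.toFinset_card]
  -- The width and one factor 2 of the normalizer cancel, leaving one factor 1/2 per parent type,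
  -- which matches `half_exp_neg_le_one_sub_div_pow`.
  have h2 : 2 * (H.width (H.π v) : ℝ) * (1 / H.normalizer v * p1 * p2) =
      (1 / 2) ^ (parents B (H.π v)).ncard * (p1 * p2) := by
    unfold Lift.normalizer
    rw [pow_add, div_pow, one_pow]
    field_simp
  rw [h2, Finset.prod_mul_distrib (f := fun _ => (1 / 2 : ℝ)), Finset.prod_const, Finset.card_univ,
    hcard]
  calc (1 / 2 : ℝ) ^ (parents B (H.π v)).ncard * (p1 * p2)
      ≤ (1 / 2) ^ (parents B (H.π v)).ncard *
        (((∏ a : parents B (H.π v), Real.exp (-lam ⟨(a.1, H.π v), a.2⟩)) *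
      ∏ u : parents H.graph v, lam (H.edgeType ⟨(u.1, v), u.2⟩)) * p2) := by gcongr
    _ = _ := by
      simp only [hp2, Finset.prod_mul_distrib]
      ring

end Alpha

/-! ### Construction of the tags. -/

section Tags

universe u v

variable {VB : Type u} {B : Digraph VB} {𝔹 : PMod.{u, v} B} {n0 : 𝔹.I → ℕ} {n : VB → ℕ}

open scoped Classical in
/-- A finite set can be split evenly among the elements of a finite set. -/
theorem exists_even_split {V : Type*} [Fintype V] (p : V → Prop) (k : ℕ) :
    ∃ t : Fin k → Option V, (∀ j v, t j = some v → p v) ∧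
      ∀ v, p v → k / Fintype.card {v // p v} ≤ (Finset.univ.filter fun j => t j = some v).card := by
  set c := Fintype.card {v // p v} with hc
  let e : {v // p v} ≃ Fin c := Fintype.equivFin _
  -- Round-robin: `j` receives the element numbered `j mod c`, so each complete block of `c` indices
  -- meets every element once.
  refine ⟨fun j => if h : 0 < c then some (e.symm ⟨j % c, Nat.mod_lt _ h⟩).1 else none,
    fun j v hj => ?_, fun v hv => ?_⟩
  · dsimp only at hj
    split_ifs at hj with h
    rw [← Option.some_injective _ hj]
    exact (e.symm ⟨j % c, Nat.mod_lt _ h⟩).2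
  · have h0 : 0 < c := Fintype.card_pos_iff.2 ⟨⟨v, hv⟩⟩
    have hlt : ∀ q : Fin (k / c), c * q + (e ⟨v, hv⟩ : ℕ) < k := fun q => by
      have h1 : c * (q + 1) ≤ c * (k / c) := Nat.mul_le_mul_left _ q.2
      have h2 := Nat.mul_div_le k c
      have h3 := (e ⟨v, hv⟩).2
      rw [mul_add] at h1
      omega
    rw [← Fintype.card_fin (k / c), ← Finset.card_univ]
    refine Finset.card_le_card_of_injOn (fun q => ⟨c * q + (e ⟨v, hv⟩ : ℕ), hlt q⟩)
      (fun q _ => ?_) fun q _ q' _ h => ?_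
    · simp [h0, Nat.mod_eq_of_lt (e ⟨v, hv⟩).2]
    · have h1 := congrArg Fin.val h
      simp only [add_left_inj] at h1
      exact Fin.ext (Nat.eq_of_mul_eq_mul_left h0 h1)

open scoped Classical in
/-- Each vertex of the fully-connected lift can be assigned a vertex of the same type in `H`,
following the input connections and evenly over each non-initial type. -/
theorem exists_tag [Fintype VB] (hn : ∀ b : 𝔹.I, n b = n0 b) (H : Lift 𝔹 n0) :
    ∃ tag : (Σ b, Fin (n b)) → Option H.V, (∀ x v, tag x = some v → H.π v = x.1) ∧
      (∀ x v, tag x = some v → ∀ (hv : H.π v ∈ 𝔹.I) (hx : x.1 ∈ 𝔹.I),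
        H.c ⟨v, hv⟩ = ⟨⟨x.1, hx⟩, Fin.cast (hn ⟨x.1, hx⟩) x.2⟩) ∧
      (∀ v, H.π v ∈ 𝔹.I → 1 ≤ (Finset.univ.filter fun x => tag x = some v).card) ∧
      ∀ v, H.π v ∉ 𝔹.I →
        n (H.π v) / H.width (H.π v) ≤ (Finset.univ.filter fun x => tag x = some v).card := by
  choose t ht1 ht2 using fun b : VB => exists_even_split (fun v : H.V => H.π v = b) (n b)
  let q : (x : Σ b, Fin (n b)) → x.1 ∈ 𝔹.I → H.V → Prop := fun x hx v =>
    ∃ hv : H.π v ∈ 𝔹.I, H.c ⟨v, hv⟩ = ⟨⟨x.1, hx⟩, Fin.cast (hn ⟨x.1, hx⟩) x.2⟩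
  have hqtype : ∀ x hx v, q x hx v → H.π v = x.1 := fun x hx v ⟨hv, h⟩ => by
    rw [← H.c_type ⟨v, hv⟩, h]
  let tag : (Σ b, Fin (n b)) → Option H.V := fun x =>
    if hx : x.1 ∈ 𝔹.I then if h : ∃ v, q x hx v then some h.choose else none else t x.1 x.2
  have htagI : ∀ x (hx : x.1 ∈ 𝔹.I) v, tag x = some v ↔ q x hx v := fun x hx v => by
    simp only [tag, dif_pos hx]
    constructor
    · intro h
      split_ifs at h with h'
      rw [← Option.some_injective _ h]
      exact h'.choose_spec
    · intro h
      have h' : ∃ v, q x hx v := ⟨v, h⟩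
      rw [dif_pos h']
      obtain ⟨hv, h1⟩ := h
      obtain ⟨hv', h1'⟩ := h'.choose_spec
      -- Injectivity of the input connection makes the witness vertex over a given input unique, so
      -- the choice is irrelevant.
      have := H.c_injective (h1'.trans h1.symm)
      exact congrArg some (congrArg Subtype.val this)
  have htype : ∀ x v, tag x = some v → H.π v = x.1 := fun x v h => by
    by_cases hx : x.1 ∈ 𝔹.I
    · exact hqtype x hx v ((htagI x hx v).1 h)
    · simp only [tag, dif_neg hx] at h
      exact ht1 _ _ _ h
  refine ⟨tag, htype, fun x v h hv hx => ((htagI x hx v).1 h).2, fun v hv => ?_, fun v hv => ?_⟩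
  · refine Finset.card_pos.2 ?_
    have h1 : (H.c ⟨v, hv⟩).1 = ⟨H.π v, hv⟩ := Subtype.ext (H.c_type ⟨v, hv⟩)
    refine ⟨⟨(H.c ⟨v, hv⟩).1, Fin.cast (hn _).symm (H.c ⟨v, hv⟩).2⟩, ?_⟩
    rw [Finset.mem_filter]
    exact ⟨Finset.mem_univ _, (htagI _ (H.c ⟨v, hv⟩).1.2 v).2 ⟨hv, rfl⟩⟩
  · have h1 := ht2 (H.π v) v rfl
    have h2 : Fintype.card {v' // H.π v' = H.π v} = H.width (H.π v) := by
      rw [Lift.width, ← Nat.card_coe_set_eq, Nat.card_eq_fintype_card]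
      exact Fintype.card_congr (Equiv.refl _)
    rw [h2] at h1
    refine h1.trans ?_
    rw [← Finset.card_map (⟨fun j => ⟨H.π v, j⟩, fun i j h => by simpa using h⟩ :
      Fin (n (H.π v)) ↪ Σ b, Fin (n b))]
    refine Finset.card_le_card fun x hx => ?_
    obtain ⟨j, hj, rfl⟩ := Finset.mem_map.1 hx
    simp only [Finset.mem_filter, Finset.mem_univ, true_and] at hj ⊢
    exact (dif_neg hv).trans hj

end Tags

/-! ### Reduction of the random lift to independent pairs of bits. -/

section Configuration

universe u v

variable {VB : Type u} {B : Digraph VB} {𝔹 : PMod.{u, v} B} {n0 : 𝔹.I → ℕ} {n : VB → ℕ}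

/-- The weights of an edge of the fully-connected lift that are close to the weight of the edge of
`H` prescribed by the tags of its endpoints. -/
def goodWeights (H : Lift 𝔹 n0) (wH : Param H) (tag : (Σ b, Fin (n b)) → Option H.V) (η : ℝ)
    (e : Edge (fcGraph B n)) : Set (𝔹.W (fcType e)) :=
  {x | ∃ u v, tag e.1.1 = some u ∧ tag e.1.2 = some v ∧
      ∃ (h : H.graph.Adj u v) (he : H.edgeType ⟨(u, v), h⟩ = fcType e),
        ‖x - castW 𝔹 he (wH ⟨(u, v), h⟩)‖ ≤ η}

theorem goodWeights_eq {H : Lift 𝔹 n0} {wH : Param H} {tag : (Σ b, Fin (n b)) → Option H.V} {η : ℝ}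
    {e : Edge (fcGraph B n)} {u v : H.V} (hu : tag e.1.1 = some u) (hv : tag e.1.2 = some v)
    (h : H.graph.Adj u v) (he : H.edgeType ⟨(u, v), h⟩ = fcType e) :
    goodWeights H wH tag η e = Metric.closedBall (castW 𝔹 he (wH ⟨(u, v), h⟩)) η := by
  ext x
  simp only [goodWeights, Set.mem_ofPred_eq, Metric.mem_closedBall, dist_eq_norm]
  constructor
  · rintro ⟨u', v', hu', hv', h', he', hx⟩
    rw [hu] at hu'
    rw [hv] at hv'
    obtain rfl := Option.some_injective _ hu'
    obtain rfl := Option.some_injective _ hv'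
    exact hx
  · exact fun hx => ⟨u, v, hu, hv, h, he, hx⟩

theorem measurableSet_goodWeights (H : Lift 𝔹 n0) (wH : Param H)
    (tag : (Σ b, Fin (n b)) → Option H.V) (η : ℝ) (e : Edge (fcGraph B n)) :
    MeasurableSet (goodWeights H wH tag η e) := by
  by_cases hc : ∃ u v, tag e.1.1 = some u ∧ tag e.1.2 = some v ∧
      ∃ (h : H.graph.Adj u v), H.edgeType ⟨(u, v), h⟩ = fcType e
  · obtain ⟨u, v, hu, hv, h, he⟩ := hc
    rw [goodWeights_eq hu hv h he]
    exact Metric.isClosed_closedBall.measurableSet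
  · have : goodWeights H wH tag η e = ∅ := by
      refine Set.eq_empty_of_forall_notMem fun x hx => hc ?_
      obtain ⟨u, v, hu, hv, h, he, -⟩ := hx
      exact ⟨u, v, hu, hv, h, he⟩
    rw [this]
    exact MeasurableSet.empty

theorem measure_closedBall_castW (N : ∀ e : Edge B, Measure (𝔹.W e)) {e e' : Edge B} (h : e = e')
    (c : 𝔹.W e) (η : ℝ) :
    (N e').real (Metric.closedBall (castW 𝔹 h c) η) = (N e).real (Metric.closedBall c η) := by
  subst h
  rfl

open scoped Classical in
/-- Presence of the edges of the fully-connected lift, and closeness of their weights to those of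
`H`. -/
noncomputable def config {Ω : Type*} (H : Lift 𝔹 n0) (wH : Param H)
    (tag : (Σ b, Fin (n b)) → Option H.V) (η : ℝ) (m : Edge (fcGraph B n) → Ω → Bool)
    (w : ∀ e : Edge (fcGraph B n), Ω → 𝔹.W (fcType e)) (e : Edge (fcGraph B n)) (ω : Ω) :
    Bool × Bool :=
  (m e ω, if w e ω ∈ goodWeights H wH tag η e then true else false)

variable {Ω : Type*} [MeasurableSpace Ω] {P : Measure Ω}
  {lam : Edge B → ℝ} {N : ∀ e : Edge B, Measure (𝔹.W e)} {m : Edge (fcGraph B n) → Ω → Bool}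
  {w : ∀ e : Edge (fcGraph B n), Ω → 𝔹.W (fcType e)}

theorem measurable_goodWeights_indicator (H : Lift 𝔹 n0) (wH : Param H)
    (tag : (Σ b, Fin (n b)) → Option H.V) (η : ℝ) (e : Edge (fcGraph B n))
    [DecidablePred (· ∈ goodWeights H wH tag η e)] :
    Measurable fun x => if x ∈ goodWeights H wH tag η e then true else false :=
  Measurable.ite (measurableSet_goodWeights H wH tag η e) measurable_const measurable_const

theorem measurable_config [Fintype VB] (hr : IsRandomSparseLift P lam N m w) (H : Lift 𝔹 n0) (wH : Param H)
    (tag : (Σ b, Fin (n b)) → Option H.V) (η : ℝ) (e : Edge (fcGraph B n)) :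
    Measurable (config H wH tag η m w e) := by
  classical
  exact (hr.measurable_mask e).prodMk
    ((measurable_goodWeights_indicator H wH tag η e).comp (hr.measurable_weight e))

theorem measureReal_mask (hlam : ∀ e, 0 < lam e) (hr : IsRandomSparseLift P lam N m w)
    (e : Edge (fcGraph B n)) : P.real {ω | m e ω = true} = lam (fcType e) / n e.1.1.1 := by
  rw [measureReal_def, hr.mask_law, ENNReal.toReal_ofReal]
  have := (hlam (fcType e)).le
  positivity

theorem measureReal_config_absent [IsProbabilityMeasure P] (hlam : ∀ e, 0 < lam e) (hr : IsRandomSparseLift P lam N m w)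
    (H : Lift 𝔹 n0) (wH : Param H) (tag : (Σ b, Fin (n b)) → Option H.V) (η : ℝ)
    (e : Edge (fcGraph B n)) :
    P.real {ω | (config H wH tag η m w e ω).1 = false} = 1 - lam (fcType e) / n e.1.1.1 := by
  rw [← measureReal_mask hlam hr]
  refine Eq.trans ?_ (probReal_compl_eq_one_sub
    (hr.measurable_mask e (measurableSet_singleton true)))
  congr 1
  ext ω
  simp [config]

theorem measureReal_config_good (hlam : ∀ e, 0 < lam e) (hr : IsRandomSparseLift P lam N m w)
    {H : Lift 𝔹 n0} {wH : Param H} {tag : (Σ b, Fin (n b)) → Option H.V} {η : ℝ}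
    {e : Edge (fcGraph B n)} {u v : H.V} (hu : tag e.1.1 = some u) (hv : tag e.1.2 = some v)
    (h : H.graph.Adj u v) (he : H.edgeType ⟨(u, v), h⟩ = fcType e) :
    P.real {ω | config H wH tag η m w e ω = (true, true)} =
      lam (fcType e) / n e.1.1.1 *
        (N (H.edgeType ⟨(u, v), h⟩)).real (Metric.closedBall (wH ⟨(u, v), h⟩) η) := by
  have hg := measurableSet_goodWeights H wH tag η e
  have h1 : {ω | config H wH tag η m w e ω = (true, true)} =
      m e ⁻¹' {true} ∩ w e ⁻¹' goodWeights H wH tag η e := by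
    ext ω
    simp [config]
  have h2 : IndepFun (m e) (w e) P :=
    hr.indep_mask_weight.comp (measurable_pi_apply e) (measurable_pi_apply e)
  rw [h1, measureReal_def, h2.measure_inter_preimage_eq_mul _ _ (measurableSet_singleton true) hg,
    ENNReal.toReal_mul, ← measureReal_mask hlam hr, ← measure_closedBall_castW N he,
    ← goodWeights_eq hu hv h he, ← hr.weight_law e, measureReal_def, measureReal_def,
    Measure.map_apply (hr.measurable_weight e) hg]
  rfl

variable [Fintype VB] [IsProbabilityMeasure P]

/-- Each pair of bits depends on the mask and the weight of its own edge alone. Working with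
finitely many values makes the later conditioning a finite sum. -/
theorem iIndepFun_config (hr : IsRandomSparseLift P lam N m w) (H : Lift 𝔹 n0) (wH : Param H)
    (tag : (Σ b, Fin (n b)) → Option H.V) (η : ℝ) : iIndepFun (config H wH tag η m w) P := by
  classical
  have hg := fun e => measurable_goodWeights_indicator H wH tag η e
  have hψ : Measurable fun (x : ∀ e : Edge (fcGraph B n), 𝔹.W (fcType e)) e =>
      if x e ∈ goodWeights H wH tag η e then true else false :=
    measurable_pi_lambda _ fun e => (hg e).comp (measurable_pi_apply e)
  exact iIndepFun.prodMk_of_indepFun hr.measurable_mask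
    (fun e => (hg e).comp (hr.measurable_weight e)) hr.indep_mask
    (hr.indep_weight.comp _ hg)
    (hr.indep_mask_weight.comp measurable_id hψ)

open scoped Classical in
theorem prod_half_exp_le (hlam : ∀ e, 0 < lam e)
    (hsmall : ∀ e : Edge B, lam e ≤ n e.1.1 / 2 ∧ lam e ^ 2 ≤ n e.1.1 / 3) (x : Σ b, Fin (n b)) :
    ∏ a : parents B x.1, (1 / 2 * Real.exp (-lam ⟨(a.1, x.1), a.2⟩)) ≤
      ∏ y : {y // (fcGraph B n).Adj y x}, (1 - lam (fcType ⟨(y.1, x), y.2⟩) / n y.1.1) := by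
  let e : (Σ a : parents B x.1, Fin (n a.1)) ≃ {y // (fcGraph B n).Adj y x} :=
    { toFun := fun p => ⟨⟨p.1.1, p.2⟩, p.1.2⟩
      invFun := fun y => ⟨⟨y.1.1, y.2⟩, y.1.2⟩
      left_inv := fun _ => rfl
      right_inv := fun _ => rfl }
  rw [← Fintype.prod_equiv e (fun p => 1 - lam ⟨(p.1.1, x.1), p.1.2⟩ / n p.1.1) _ fun p => rfl,
    Fintype.prod_sigma]
  refine Finset.prod_le_prod (fun a _ => by positivity) fun a _ => ?_
  change _ ≤ ∏ _i : Fin (n a.1), (1 - lam ⟨(a.1, x.1), a.2⟩ / n a.1)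
  rw [Finset.prod_const, Finset.card_univ, Fintype.card_fin]
  exact half_exp_neg_le_one_sub_div_pow (hlam _).le (hsmall ⟨(a.1, x.1), a.2⟩).1
    (hsmall ⟨(a.1, x.1), a.2⟩).2

variable [Acyclic B]

-- Combines the sum over choices of sources with the definition of `alpha`: each parent `u` offers
-- at least `α u * n a` sources, whose edges are good with probability `lam / n a` times the mass of
-- a ball, and `n a` cancels.
open scoped Classical in
theorem two_mul_width_mul_alpha_le_measureReal (hlam : ∀ e, 0 < lam e)
    (hN : ∀ e, IsProbabilityMeasure (N e)) (hN' : ∀ e, (N e).IsOpenPosMeasure)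
    (hr : IsRandomSparseLift P lam N m w)
    (hsmall : ∀ e : Edge B, lam e ≤ n e.1.1 / 2 ∧ lam e ^ 2 ≤ n e.1.1 / 3)
    {H : Lift 𝔹 n0} {wH : Param H} {tag : (Σ b, Fin (n b)) → Option H.V}
    (htype : ∀ x v, tag x = some v → H.π v = x.1) {η : ℝ} (hη : 0 < η)
    {v : H.V} (hv : H.π v ∉ 𝔹.I) (s : (Σ b, Fin (n b)) → Prop)
    (hs : ∀ u, B.Adj (H.π u) (H.π v) → alpha lam N H wH η u * n (H.π u) ≤
      ((Finset.univ.filter fun y => tag y = some u ∧ s y).card : ℝ))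
    {x : Σ b, Fin (n b)} (hx : tag x = some v) :
    2 * H.width (H.π v) * alpha lam N H wH η v ≤
      P.real {ω | IsMatch H tag s (fun e => config H wH tag η m w e ω) x} := by
  have hxv := htype x v hx
  obtain ⟨b, j⟩ := x
  dsimp only at hxv
  subst hxv
  let ρ : parents H.graph v → ℝ := fun u => lam (H.edgeType ⟨(u.1, v), u.2⟩) / n (H.π u.1) *
    (N (H.edgeType ⟨(u.1, v), u.2⟩)).real (Metric.closedBall (wH ⟨(u.1, v), u.2⟩) η)
  have hρ0 : ∀ u, 0 ≤ ρ u := fun u =>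
    mul_nonneg (div_nonneg (hlam _).le (by positivity)) measureReal_nonneg
  have h1 := prod_le_measureReal_isMatch (P := P) htype (measurable_config hr H wH tag η)
    (iIndepFun_config hr H wH tag η) hx s ρ hρ0 (fun u y hy h => by
      have hyt := htype _ _ hy
      obtain ⟨a, i⟩ := y
      dsimp only at hyt
      subst hyt
      exact (measureReal_config_good hlam hr
        (e := ⟨(⟨H.π u.1, i⟩, ⟨H.π v, j⟩), h⟩) hy hx u.2 rfl).ge)
  refine (two_mul_width_mul_alpha_le hlam hN hN' H wH hη v hv).trans (le_trans ?_ h1)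
  refine mul_le_mul ?_ ?_ (Finset.prod_nonneg fun _ _ => by positivity)
    (Finset.prod_nonneg fun u _ => mul_nonneg (Nat.cast_nonneg _) (hρ0 u))
  · refine Finset.prod_le_prod (fun u _ => mul_nonneg
      (alpha_pos_and_le_one hlam hN hN' H wH hη _).1.le
      (mul_nonneg (hlam _).le measureReal_nonneg)) fun u _ => ?_
    -- Positivity, needed to cancel `n`, comes from `0 < lam ≤ n / 2`.
    have hn : (0 : ℝ) < n (H.π u.1) := by
      have h2 := (hsmall (H.edgeType ⟨(u.1, v), u.2⟩)).1
      have h3 := hlam (H.edgeType ⟨(u.1, v), u.2⟩)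
      change _ ≤ (n (H.π u.1) : ℝ) / 2 at h2
      linarith
    refine le_trans (le_of_eq ?_) (mul_le_mul_of_nonneg_right (hs u.1 (H.hom _ _ u.2)) (hρ0 u))
    simp only [ρ]
    field_simp
  · refine (prod_half_exp_le hlam hsmall ⟨H.π v, j⟩).trans (le_of_eq ?_)
    exact Finset.prod_congr rfl fun y _ => (measureReal_config_absent hlam hr H wH tag η _).symm

/-- With `J ≥ n / w - 1` trials of probability `p = 2 w α ≤ 1` the mean is at least `2 T - 1`. Since
`2 (1 - 1/e) > 1`, the exponent is negative of order `T`, and the factor 8 suffices to reach `-(1 +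
Λ)`. -/
theorem lower_tail_exponent_le {T J p w n α Λ : ℝ} (hw : 0 < w) (hα : 0 < α) (hT : T = α * n)
    (hJ : n - w ≤ w * J) (hp : p = 2 * w * α) (hp1 : p ≤ 1) (hΛ : 0 ≤ Λ) (h8 : 8 * (1 + Λ) ≤ T) :
    T - (1 - Real.exp (-1)) * (J * p) ≤ -(1 + Λ) := by
  have h1 := Real.exp_neg_one_lt_d9
  have h2 : 2 * T - 1 ≤ J * p := by
    have : 2 * α * (n - w) ≤ 2 * α * (w * J) := by gcongr
    subst hT hp
    nlinarith
  have h3 : 0 ≤ J * p := by linarith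
  nlinarith

theorem measureReal_first_failure_config_le (hlam : ∀ e, 0 < lam e)
    (hN : ∀ e, IsProbabilityMeasure (N e)) (hN' : ∀ e, (N e).IsOpenPosMeasure)
    (hr : IsRandomSparseLift P lam N m w)
    (hsmall : ∀ e : Edge B, lam e ≤ n e.1.1 / 2 ∧ lam e ^ 2 ≤ n e.1.1 / 3)
    {H : Lift 𝔹 n0} {wH : Param H} {tag : (Σ b, Fin (n b)) → Option H.V}
    (htype : ∀ x v, tag x = some v → H.π v = x.1) {η : ℝ} (hη : 0 < η)
    {v : H.V} (hv : H.π v ∉ 𝔹.I)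
    (htag : n (H.π v) / H.width (H.π v) ≤ {x | tag x = some v}.ncard)
    {r : VB → ℕ} (hrank : ∀ a b, B.Adj a b → r a < r b) {Λ : ℝ} (hΛ : 0 ≤ Λ)
    (h8 : 8 * (1 + Λ) ≤ alpha lam N H wH η v * n (H.π v)) :
    P.real {ω | (∀ u, r (H.π u) < r (H.π v) → alpha lam N H wH η u * n (H.π u) ≤
        coverCard H tag (fun e => config H wH tag η m w e ω) u) ∧
      (coverCard H tag (fun e => config H wH tag η m w e ω) v : ℝ) <
        alpha lam N H wH η v * n (H.π v)} ≤ Real.exp (-(1 + Λ)) := by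
  classical
  refine measureReal_first_failure_le htype (measurable_config hr H wH tag η)
    (iIndepFun_config hr H wH tag η) hrank v (fun u => alpha lam N H wH η u * n (H.π u))
    (Real.exp_pos _).le fun s hs => ?_
  have hpos := (alpha_pos_and_le_one hlam hN hN' H wH hη v).1
  have hp := fun x (hx : tag x = some v) => two_mul_width_mul_alpha_le_measureReal hlam hN hN' hr
    hsmall htype hη hv s (fun u hu => by convert hs u (hrank _ _ hu)) hx
  have h1 := measureReal_card_isMatch_le (measurable_config hr H wH tag η)
    (iIndepFun_config hr H wH tag η) v s _ (alpha lam N H wH η v * n (H.π v)) hp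
  refine (measureReal_mono (fun ω hω => ?_) (measure_ne_top _ _)).trans
    (h1.trans (Real.exp_le_exp.2 ?_))
  · simp only [Set.mem_ofPred_eq] at hω ⊢
    convert hω.le
  · have hw : 0 < H.width (H.π v) := H.width_pos v
    have hcard : {x | tag x = some v}.ncard = (Finset.univ.filter fun x => tag x = some v).card := by
      rw [← Set.ncard_coe_finset]
      congr 1
      ext x
      simp
    rw [hcard] at htag
    refine lower_tail_exponent_le (w := H.width (H.π v)) (by exact_mod_cast hw) hpos rfl ?_ rfl ?_
      hΛ h8
    · have h2 := Nat.div_add_mod (n (H.π v)) (H.width (H.π v))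
      have h3 := Nat.mod_lt (n (H.π v)) hw
      have h4 := Nat.mul_le_mul_left (H.width (H.π v)) htag
      have h5 : n (H.π v) ≤ H.width (H.π v) * (Finset.univ.filter fun x => tag x = some v).card +
        H.width (H.π v) := by omega
      rw [sub_le_iff_le_add]
      exact_mod_cast h5
    · exact two_mul_width_mul_alpha_le_one hlam hN hN' H wH hη v hv

end Configuration

/-! ### Out-degrees, parentless types, and robustness to perturbations. -/

section Assembly

universe u v

variable {VB : Type u} {B : Digraph VB} {𝔹 : PMod.{u, v} B} {n0 : 𝔹.I → ℕ} {n : VB → ℕ}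

/-- For `a ≥ 3` because `log a ≥ 1`; the case `a = 2` uses that `b` is an integer and `2 log 2 > 1`.
-/
theorem natCast_le_of_mul_log_le {a b : ℕ} (ha : 0 < a) (hb : 0 < b) (h : (a : ℝ) * Real.log a ≤ b) :
    (a : ℝ) ≤ b := by
  rcases Nat.lt_or_ge a 3 with h3 | h3
  · interval_cases a
    · exact_mod_cast hb
    · have h2 := Real.log_two_gt_d9
      push_cast at h ⊢
      have h4 : (1 : ℝ) < b := by linarith
      have h5 : 1 < b := by exact_mod_cast h4
      exact_mod_cast h5
  · have h4 : (3 : ℝ) ≤ a := by exact_mod_cast h3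
    have h5 : 1 ≤ Real.log a := by
      rw [Real.le_log_iff_exp_le (by linarith)]
      have := Real.exp_one_lt_d9
      linarith
    nlinarith

open scoped Classical in
/-- Upper tail of the out-degrees of the random sparse lift. -/
theorem measureReal_outdegree_gt_le {Ω : Type*} [MeasurableSpace Ω] {P : Measure Ω}
    [IsProbabilityMeasure P] {lam : Edge B → ℝ} {N : ∀ e : Edge B, Measure (𝔹.W e)}
    {m : Edge (fcGraph B n) → Ω → Bool} {w : ∀ e : Edge (fcGraph B n), Ω → 𝔹.W (fcType e)}
    (hlam : ∀ e, 0 < lam e) (hr : IsRandomSparseLift P lam N m w) (e : Edge B)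
    (hgrowth : (n e.1.1 : ℝ) * Real.log (n e.1.1) ≤ n e.1.2) (hb : 0 < n e.1.2)
    (i : Fin (n e.1.1)) {l L : ℝ} (hl : 0 ≤ l) (hL : 7 * lam e + 1 + l ≤ L) :
    P.real {ω | L * (n e.1.2 / n e.1.1) < ((Finset.univ.filter fun j : Fin (n e.1.2) =>
        m ⟨(⟨e.1.1, i⟩, ⟨e.1.2, j⟩), e.2⟩ ω = true).card : ℝ)} ≤ Real.exp (-l) / n e.1.1 := by
  let Y : Fin (n e.1.2) → Ω → Bool := fun j => m ⟨(⟨e.1.1, i⟩, ⟨e.1.2, j⟩), e.2⟩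
  have hind : iIndepFun Y P := hr.indep_mask.precomp
    (g := fun j : Fin (n e.1.2) => (⟨(⟨e.1.1, i⟩, ⟨e.1.2, j⟩), e.2⟩ : Edge (fcGraph B n)))
    fun j j' h => by simpa using congrArg (fun e : Edge (fcGraph B n) => e.1.2) h
  have ha : 0 < n e.1.1 := i.pos
  have ha' : (0 : ℝ) < n e.1.1 := by exact_mod_cast ha
  set q : ℝ := n e.1.2 / n e.1.1 with hq
  have hq1 : 1 ≤ q := by
    rw [hq, one_le_div ha']
    exact natCast_le_of_mul_log_le ha hb hgrowth
  have hqlog : Real.log (n e.1.1) ≤ q := by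
    rw [hq, le_div_iff₀ ha', mul_comm]
    exact hgrowth
  have h1 := count_upper_tail (fun j => hr.measurable_mask _) hind (L * q)
  have h2 : ∑ j, P.real {ω | Y j ω = true} = lam e * q := by
    have : ∀ j, P.real {ω | Y j ω = true} = lam e / n e.1.1 := fun j => measureReal_mask hlam hr _
    simp_rw [this]
    rw [Finset.sum_const, Finset.card_univ, Fintype.card_fin, nsmul_eq_mul, hq]
    ring
  rw [h2] at h1
  have h3 : Real.exp (-l) / n e.1.1 = Real.exp (-l - Real.log (n e.1.1)) := by
    rw [Real.exp_sub, Real.exp_log ha']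
  rw [h3]
  refine (measureReal_mono (fun ω hω => ?_) (measure_ne_top _ _)).trans
    (h1.trans (Real.exp_le_exp.2 ?_))
  · simp only [Set.mem_ofPred_eq] at hω ⊢
    rw [Finset.sum_boole]
    exact hω.le
  -- The term `7 lam` dominates the exponential moment, as `e - 1 < 7`. The remaining `(1 + l) q` is
  -- at least `log (n a) + l`, by `q ≥ log (n a)` and `q ≥ 1`.
  · have h4 := Real.exp_one_lt_d9
    have h5 := hlam e
    have h6 : (7 * lam e + 1 + l) * q ≤ L * q := mul_le_mul_of_nonneg_right hL (by linarith)
    have h7 : (Real.exp 1 - 1) * (lam e * q) ≤ 7 * (lam e * q) :=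
      mul_le_mul_of_nonneg_right (by linarith) (by positivity)
    nlinarith

open scoped Classical in
/-- A small perturbation changes few weights. -/
theorem card_perturbed_le {G : Lift 𝔹 n0} (w w' : Param G) {η R : ℝ} (hη : 0 < η)
    (h : paramDist w w' ≤ R) :
    ((Finset.univ.filter fun e => ¬ ‖w e - w' e‖ ≤ η / 2).card : ℝ) ≤ 4 * (R ^ 2 / η ^ 2) := by
  have h1 : ∑ e, ‖w e - w' e‖ ^ 2 ≤ R ^ 2 := by
    have h0 : 0 ≤ ∑ e, ‖w e - w' e‖ ^ 2 := Finset.sum_nonneg fun _ _ => sq_nonneg _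
    rw [← Real.sq_sqrt h0]
    exact pow_le_pow_left₀ (Real.sqrt_nonneg _) h 2
  -- Chebyshev: each edge counted contributes at least `(η / 2)²` to the squared distance.
  have h2 : ((Finset.univ.filter fun e => ¬ ‖w e - w' e‖ ≤ η / 2).card : ℝ) * (η / 2) ^ 2 ≤
      ∑ e, ‖w e - w' e‖ ^ 2 := by
    rw [← nsmul_eq_mul, ← Finset.sum_const]
    refine (Finset.sum_le_sum fun e he => ?_).trans (Finset.sum_le_sum_of_subset_of_nonneg
      (Finset.subset_univ _) fun _ _ _ => sq_nonneg _)
    have h3 := not_le.1 (Finset.mem_filter.1 he).2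
    exact pow_le_pow_left₀ (by linarith) h3.le 2
  rw [← mul_div_assoc, le_div_iff₀ (by positivity)]
  nlinarith

theorem covered_of_parents_eq_empty {H : Lift 𝔹 n0} {tag : (Σ b, Fin (n b)) → Option H.V}
    (htype : ∀ x v, tag x = some v → H.π v = x.1) (ξ : Edge (fcGraph B n) → Bool × Bool) {v : H.V}
    (hv : parents B (H.π v) = ∅) {x : Σ b, Fin (n b)} (hx : tag x = some v) :
    Covered H tag ξ x := by
  have h1 : IsEmpty (parents H.graph v) := ⟨fun u => by
    have h2 : H.π u.1 ∈ parents B (H.π v) := H.hom _ _ u.2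
    rw [hv] at h2
    exact h2⟩
  refine ⟨x, v, hx, fun u => isEmptyElim u, fun u => isEmptyElim u, fun u => isEmptyElim u,
    fun u => isEmptyElim u, fun y hy => ?_⟩
  have h2 : y.1 ∈ parents B (H.π v) := by
    rw [htype _ _ hx]
    exact hy
  rw [hv] at h2
  exact absurd h2 (Set.notMem_empty _)

theorem coverCard_of_parents_eq_empty [Fintype VB] {H : Lift 𝔹 n0}
    {tag : (Σ b, Fin (n b)) → Option H.V} (htype : ∀ x v, tag x = some v → H.π v = x.1)
    (ξ : Edge (fcGraph B n) → Bool × Bool) {v : H.V} (hv : parents B (H.π v) = ∅) :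
    coverCard H tag ξ v = {x | tag x = some v}.ncard := by
  classical
  rw [coverCard, ← Set.ncard_coe_finset]
  congr 1
  ext x
  simpa using covered_of_parents_eq_empty htype ξ hv

variable [Fintype VB] [Acyclic B] {lam : Edge B → ℝ} {N : ∀ e : Edge B, Measure (𝔹.W e)}

/-- At the types without parents, the number of covered vertices is deterministic. -/
theorem alpha_mul_le_coverCard_of_parents_eq_empty (hlam : ∀ e, 0 < lam e)
    (hN : ∀ e, IsProbabilityMeasure (N e)) (hN' : ∀ e, (N e).IsOpenPosMeasure)
    (hn : ∀ b : 𝔹.I, n b = n0 b) {H : Lift 𝔹 n0} {wH : Param H}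
    {tag : (Σ b, Fin (n b)) → Option H.V} (htype : ∀ x v, tag x = some v → H.π v = x.1)
    {η : ℝ} (hη : 0 < η) (ξ : Edge (fcGraph B n) → Bool × Bool) {v : H.V}
    (hinput : H.π v ∈ 𝔹.I → 1 ≤ {x | tag x = some v}.ncard)
    (htag : H.π v ∉ 𝔹.I → n (H.π v) / H.width (H.π v) ≤ {x | tag x = some v}.ncard)
    (h8 : H.π v ∉ 𝔹.I → 8 ≤ alpha lam N H wH η v * n (H.π v))
    (hv : parents B (H.π v) = ∅) :
    alpha lam N H wH η v * n (H.π v) ≤ coverCard H tag ξ v := by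
  classical
  rw [coverCard_of_parents_eq_empty htype ξ hv]
  by_cases hI : H.π v ∈ 𝔹.I
  · have h1 : (0 : ℝ) < n0 ⟨H.π v, hI⟩ := by exact_mod_cast H.inputs_pos v hI
    rw [alpha_eq, dif_pos hI, show n (H.π v) = n0 ⟨H.π v, hI⟩ from hn ⟨H.π v, hI⟩,
      one_div_mul_cancel h1.ne']
    exact_mod_cast hinput hI
  · have hw : 0 < H.width (H.π v) := H.width_pos v
    have hw' : (1 : ℝ) ≤ H.width (H.π v) := by exact_mod_cast hw
    have h2 := Nat.div_add_mod (n (H.π v)) (H.width (H.π v))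
    have h3 := Nat.mod_lt (n (H.π v)) hw
    have h4 := Nat.mul_le_mul_left (H.width (H.π v)) (htag hI)
    have h5 : n (H.π v) ≤ H.width (H.π v) * {x | tag x = some v}.ncard + H.width (H.π v) := by
      omega
    have h6 : (n (H.π v) : ℝ) ≤ H.width (H.π v) * {x | tag x = some v}.ncard + H.width (H.π v) := by
      exact_mod_cast h5
    have h7 := two_mul_width_mul_alpha_le_one hlam hN hN' H wH hη v hI
    have h9 := h8 hI
    set α := alpha lam N H wH η v
    -- Writing `J` for the number of tags, this gives `2 α n ≤ J + 1`, and `α n ≥ 8` absorbs the 1.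
    have h10 : 2 * H.width (H.π v) * (α * n (H.π v)) ≤ n (H.π v) := by
      rw [← mul_assoc]
      exact mul_le_of_le_one_left (by positivity) h7
    refine le_of_mul_le_mul_left ?_ (by linarith : (0 : ℝ) < H.width (H.π v))
    nlinarith

/-- If every vertex of the witness has enough covered preimages, the out-degrees are controlled and
the widths are large, then covers survive small perturbations of the weights. -/
theorem hasCover_of_coverCard (hn : ∀ b : 𝔹.I, n b = n0 b) (H : Lift 𝔹 n0) (wH : Param H)
    {tag : (Σ b, Fin (n b)) → Option H.V} (htype : ∀ x v, tag x = some v → H.π v = x.1)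
    (hinput : ∀ x v, tag x = some v → ∀ (hv : H.π v ∈ 𝔹.I) (hx : x.1 ∈ 𝔹.I),
      H.c ⟨v, hv⟩ = ⟨⟨x.1, hx⟩, Fin.cast (hn ⟨x.1, hx⟩) x.2⟩)
    {Ω : Type*} (m : Edge (fcGraph B n) → Ω → Bool)
    (w0 : ∀ e : Edge (fcGraph B n), Ω → 𝔹.W (fcType e)) (ω : Ω) {η R : ℝ} (hη : 0 < η)
    (hR : 0 ≤ R) {α : H.V → ℝ} {A : ℝ} (hA : 0 < A) (hAα : ∀ v, A ≤ α v)
    (hcov : ∀ v, α v * n (H.π v) ≤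
      coverCard H tag (fun e => config H wH tag (η / 2) m w0 e ω) v)
    (L : Edge B → ℝ) (hL : ∀ e, 0 ≤ L e)
    (hdeg : ∀ (e : Edge B) (i : Fin (n e.1.1)),
      (({j : Fin (n e.1.2) | m ⟨(⟨e.1.1, i⟩, ⟨e.1.2, j⟩), e.2⟩ ω = true}.ncard : ℕ) : ℝ) ≤
        L e * (n e.1.2 / n e.1.1))
    (hwidth : ∀ b, b ∉ 𝔹.I →
      8 * ((R + η) ^ 2 / η ^ 2) * (1 + ∑ e, L e) ^ (1 + Fintype.card VB) ≤ A * n b)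
    (w : Param (sparseLift hn fun e => m e ω))
    (hw : paramDist w (restrictParam hn (fun e => m e ω) fun e => w0 e ω) ≤ R) :
    HasCover w wH (fun v => 1 / 2 * α v) η := by
  classical
  obtain ⟨r, hrank, hrle⟩ := exists_rank B
  set Λ := ∑ e, L e with hΛ
  have hΛ0 : 0 ≤ Λ := Finset.sum_nonneg fun e _ => hL e
  let bad : Edge (sparseLift hn fun e => m e ω).graph → Prop := fun e =>
    ¬ ‖w e - restrictParam hn (fun e => m e ω) (fun e => w0 e ω) e‖ ≤ η / 2
  have hbadcard : ((@Finset.filter _ bad (fun e => Classical.propDecidable (bad e))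
      Finset.univ).card : ℝ) ≤ 4 * (R ^ 2 / η ^ 2) := by
    convert card_perturbed_le w _ hη hw
  -- Chosen so that after multiplication by at most `(1 + Λ) ^ (1 + card VB)` the affected
  -- proportion is still at most `A / 2`.
  set q : ℝ := A / (2 * (1 + Λ) ^ (1 + Fintype.card VB)) with hq
  have hq0 : 0 ≤ q := by positivity
  have haff := card_affected_le hrank (fun e => m e ω) bad L hL
    (fun e i => by
      refine le_trans (le_of_eq ?_) (hdeg e i)
      rw [← Set.ncard_coe_finset]
      congr 2
      ext j
      simp) q hq0
    (fun b ⟨a, hab⟩ => by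
      have hb : b ∉ 𝔹.I := fun hb => by
        have h1 : a ∈ parents B b := hab
        rw [𝔹.parents_eq_empty b hb] at h1
        exact h1
      have h1 : R ^ 2 / η ^ 2 ≤ (R + η) ^ 2 / η ^ 2 := by gcongr; linarith
      have h2 : 4 * ((R + η) ^ 2 / η ^ 2) ≤ q * n b := by
        rw [hq, div_mul_eq_mul_div, le_div_iff₀ (by positivity)]
        have := hwidth b hb
        linarith
      refine le_trans ?_ ((mul_le_mul_of_nonneg_left h1 (by norm_num)).trans h2)
      exact hbadcard)
  refine hasCover_of_card hn H wH tag htype hinput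
    (fun e => config H wH tag (η / 2) m w0 e ω) (fun e => w0 e ω) η (fun e he => ?_)
    (fun e => m e ω) (fun _ => rfl) w bad (fun e he => not_not.1 he) _ fun v => ?_
  · have h1 : w0 e ω ∈ goodWeights H wH tag (η / 2) e := by
      by_contra hcon
      simp [config, hcon] at he
    exact h1
  · set ξ : Edge (fcGraph B n) → Bool × Bool := fun e => config H wH tag (η / 2) m w0 e ω
    set D := Finset.univ.filter fun i : Fin (n (H.π v)) =>
      Affected (sparseGraph fun e => m e ω) bad ⟨H.π v, i⟩ with hD
    have h1 : (D.card : ℝ) ≤ 1 / 2 * α v * n (H.π v) := by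
      refine (haff (H.π v)).trans (mul_le_mul_of_nonneg_right ?_ (Nat.cast_nonneg _))
      have h2 : (1 + Λ) ^ r (H.π v) ≤ (1 + Λ) ^ (1 + Fintype.card VB) :=
        pow_le_pow_right₀ (by linarith) (by have := hrle (H.π v); omega)
      have h3 : q * (1 + Λ) ^ (1 + Fintype.card VB) = A / 2 := by
        rw [hq]; field_simp
      have h4 := mul_le_mul_of_nonneg_left h2 hq0
      have h5 := hAα v
      linarith
    have h2 : coverCard H tag ξ v ≤ ({x | Covered H tag ξ x ∧ tag x = some v ∧
        ¬ Affected (sparseLift hn fun e => m e ω).graph bad x} : Set (Σ b, Fin (n b))).ncard +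
        D.card := by
      rw [coverCard, ← Finset.card_map (⟨fun j => ⟨H.π v, j⟩, fun i j h => by simpa using h⟩ :
        Fin (n (H.π v)) ↪ Σ b, Fin (n b)), ← Set.ncard_coe_finset, ← Set.ncard_coe_finset]
      refine (Set.ncard_le_ncard (fun x hx => ?_) (Set.toFinite _)).trans (Set.ncard_union_le _ _)
      have hx' : tag x = some v ∧ Covered H tag ξ x := by simpa using hx
      by_cases hx2 : Affected (sparseLift hn fun e => m e ω).graph bad x
      · right
        have hxv := htype _ _ hx'.1
        obtain ⟨b, j⟩ := x
        dsimp only at hxv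
        subst hxv
        refine Finset.mem_coe.2 (Finset.mem_map.2 ⟨j, ?_, rfl⟩)
        rw [hD, Finset.mem_filter]
        exact ⟨Finset.mem_univ _, hx2⟩
      · left
        exact ⟨hx'.2, hx'.1, hx2⟩
    have h3 : (coverCard H tag ξ v : ℝ) ≤ ({x | Covered H tag ξ x ∧ tag x = some v ∧
        ¬ Affected (sparseLift hn fun e => m e ω).graph bad x} : Set (Σ b, Fin (n b))).ncard +
        D.card := by exact_mod_cast h2
    have h4 := hcov v
    change α v * n (H.π v) ≤ (coverCard H tag ξ v : ℝ) at h4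
    change 1 / 2 * α v * n (H.π v) ≤ _
    linarith

end Assembly

/-! ### The empty witness and the union bound. -/

section Main

universe u v

variable {VB : Type u} {B : Digraph VB} {𝔹 : PMod.{u, v} B} {n0 : 𝔹.I → ℕ} {n : VB → ℕ}

theorem hasCover_of_isEmpty [Fintype VB] (hn : ∀ b : 𝔹.I, n b = n0 b) (H : Lift 𝔹 n0)
    [IsEmpty H.V] (wH : Param H) (m : Edge (fcGraph B n) → Bool) (w : Param (sparseLift hn m))
    (α : H.V → ℝ) (η : ℝ) : HasCover w wH α η :=
  hasCover_of_card hn H wH (fun _ => none) (fun _ v => isEmptyElim v) (fun _ v => isEmptyElim v)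
    (fun e => (m e, false)) (fun _ => 0) η (fun _ h => absurd h (by simp)) m (fun _ => rfl) w
    (fun _ => True) (fun _ h => absurd trivial h) α fun v => isEmptyElim v

/-- A lower bound on the probability of a set that contains everything outside two finite families
of rare events. -/
theorem one_sub_le_measureReal_of_forall {Ω : Type*} [MeasurableSpace Ω] {P : Measure Ω}
    [IsProbabilityMeasure P] {ι κ : Type*} [Fintype ι] [Fintype κ] {S : Set Ω} {D : ι → Set Ω}
    {F : κ → Set Ω} (h : ∀ ω, ω ∈ S ∨ (∃ i, ω ∈ D i) ∨ ∃ j, ω ∈ F j) :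
    1 - (∑ i, P.real (D i) + ∑ j, P.real (F j)) ≤ P.real S := by
  have h1 : (Set.univ : Set Ω) ⊆ S ∪ ((⋃ i, D i) ∪ ⋃ j, F j) := fun ω _ => by
    simpa using h ω
  have h2 := (measureReal_mono (μ := P) h1 (measure_ne_top _ _)).trans (measureReal_union_le _ _)
  have h3 := measureReal_union_le (μ := P) (⋃ i, D i) (⋃ j, F j)
  have h4 := measureReal_iUnion_fintype_le (μ := P) D
  have h5 := measureReal_iUnion_fintype_le (μ := P) F
  rw [probReal_univ] at h2
  linarith

end Main

end SparseLift

/-! ### The main theorem: choice of constants and conclusion. -/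

theorem mainTheorem6 {VB : Type*} [Fintype VB] (B : Digraph VB)
    [SparseLift.Acyclic B] (𝔹 : SparseLift.PMod B) (n0 : 𝔹.I → ℕ)
    (lam : SparseLift.Edge B → ℝ) (hlam : ∀ e, 0 < lam e)
    (N : ∀ e : SparseLift.Edge B, MeasureTheory.Measure (𝔹.W e))
    (hN_prob : ∀ e, MeasureTheory.IsProbabilityMeasure (N e))
    (hN_support : ∀ e, (N e).IsOpenPosMeasure)
    (Gstar : SparseLift.Lift 𝔹 n0) (wstar : SparseLift.Param Gstar)
    (η R δ : ℝ) (hη : 0 < η) (hR : 0 ≤ R) (hδ : 0 < δ) (hδ_le : δ ≤ 1)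
    (n : VB → ℕ) (hn : ∀ b : 𝔹.I, n b = n0 b)
    (hn_growth : ∀ e : SparseLift.Edge B, (n e.1.1 : ℝ) * Real.log (n e.1.1) ≤ n e.1.2)
    (hlam_input : ∀ (e : SparseLift.Edge B) (he : e.1.1 ∈ 𝔹.I),
      lam e ≤ min ((n0 ⟨e.1.1, he⟩ : ℝ) / 2) (Real.sqrt ((n0 ⟨e.1.1, he⟩ : ℝ) / 3)))
    (hn_width : ∀ b : VB, b ∉ 𝔹.I →
      8 * ((R + η) ^ 2 / η ^ 2) *
          ((1 + SparseLift.bigLambda lam (Fintype.card Gstar.V) δ) ^ (1 + Fintype.card VB) /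
            ⨅ x : Gstar.V, SparseLift.alpha lam N Gstar wstar (η / 2) x) ≤ (n b : ℝ))
    {Ω : Type*} [MeasurableSpace Ω] (P : MeasureTheory.Measure Ω)
    [MeasureTheory.IsProbabilityMeasure P]
    (m : SparseLift.Edge (SparseLift.fcGraph B n) → Ω → Bool)
    (w0 : ∀ e : SparseLift.Edge (SparseLift.fcGraph B n),
      Ω → 𝔹.W (SparseLift.fcType e))
    (hrandom : SparseLift.IsRandomSparseLift P lam N m w0) :
    ENNReal.ofReal (1 - δ) ≤
      P {ω | ∀ w : SparseLift.Param (SparseLift.sparseLift hn fun e => m e ω),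
        SparseLift.paramDist w
            (SparseLift.restrictParam hn (fun e => m e ω) fun e => w0 e ω) ≤ R →
          SparseLift.HasCover w wstar
            (fun x => 1 / 2 * SparseLift.alpha lam N Gstar wstar (η / 2) x) η} := by
  classical
  open SparseLift in
  -- Over an empty witness the real infimum is 0 and division by it gives 0, so the width assumption
  -- carries no information; but the empty subgraph is a cover.
  rcases isEmpty_or_nonempty Gstar.V with hV | hV
  · have h1 : {ω | ∀ w : Param (sparseLift hn fun e => m e ω),
        paramDist w (restrictParam hn (fun e => m e ω) fun e => w0 e ω) ≤ R →
          HasCover w wstar (fun x => 1 / 2 * alpha lam N Gstar wstar (η / 2) x) η} = Set.univ :=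
      Set.eq_univ_of_forall fun ω w _ => hasCover_of_isEmpty hn Gstar wstar _ w _ η
    rw [h1, measure_univ]
    exact ENNReal.ofReal_le_one.2 (by linarith)
  obtain ⟨tag, htype, hinput, htagI, htagN⟩ := exists_tag hn Gstar
  have hcard : ∀ v, {x | tag x = some v}.ncard =
      (Finset.univ.filter fun x => tag x = some v).card := fun v => by
    rw [← Set.ncard_coe_finset]
    congr 1
    ext x
    simp
  obtain ⟨r, hrank, -⟩ := exists_rank B
  have hη2 : 0 < η / 2 := by linarith
  set α := alpha lam N Gstar wstar (η / 2) with hα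
  have hα01 : ∀ v, 0 < α v ∧ α v ≤ 1 :=
    alpha_pos_and_le_one hlam hN_prob hN_support Gstar wstar hη2
  set A := ⨅ v, α v with hAdef
  have hAα : ∀ v, A ≤ α v := fun v => ciInf_le (Set.finite_range α).bddBelow v
  have hA : 0 < A := by
    obtain ⟨v, hv⟩ := exists_eq_ciInf_of_finite (f := α)
    rw [hAdef, ← hv]
    exact (hα01 v).1
  set K : ℝ := (Fintype.card Gstar.V : ℝ) + (Fintype.card (Edge B) : ℝ) with hK
  have hK1 : 1 ≤ K := by
    have h1 : (1 : ℝ) ≤ Fintype.card Gstar.V := by exact_mod_cast Fintype.card_pos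
    have h2 : (0 : ℝ) ≤ Fintype.card (Edge B) := Nat.cast_nonneg _
    linarith
  have hlogK : 0 ≤ Real.log K := Real.log_nonneg hK1
  have hlogδ : Real.log δ ≤ 0 := Real.log_nonpos hδ.le hδ_le
  have hlog2 : 0 < Real.log 2 := Real.log_pos (by norm_num)
  set l : ℝ := Real.log 2 + Real.log K - Real.log δ with hl
  have hl0 : 0 ≤ l := by linarith
  -- The failure probability allotted to each witness vertex and each base edge.
  set ε : ℝ := δ / K with hε
  have hε0 : 0 < ε := by positivity
  have hlogε : Real.log ε = Real.log δ - Real.log K := Real.log_div hδ.ne' (by linarith)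
  let L : Edge B → ℝ := fun e => 7 * lam e + 1 + Real.log 2 + Real.log K - Real.log δ
  have hL : ∀ e, 7 * lam e + 1 + l = L e := fun e => by simp only [L, hl]; ring
  have hL0 : ∀ e, 0 ≤ L e := fun e => by
    have := hlam e
    rw [← hL]
    linarith
  set Λ : ℝ := bigLambda lam (Fintype.card Gstar.V) δ with hΛ
  have hΛL : Λ = ∑ e, L e := rfl
  have hLΛ : ∀ e, L e ≤ Λ := fun e => by
    rw [hΛL]
    exact Finset.single_le_sum (fun e _ => hL0 e) (Finset.mem_univ e)
  have hΛ0 : 0 ≤ Λ := Finset.sum_nonneg fun e _ => hL0 e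
  have hwidth : ∀ b, b ∉ 𝔹.I →
      8 * ((R + η) ^ 2 / η ^ 2) * (1 + Λ) ^ (1 + Fintype.card VB) ≤ A * n b := fun b hb => by
    have h1 := hn_width b hb
    rw [← mul_div_assoc, div_le_iff₀ hA] at h1
    linarith
  -- The square is kept because `hsmall` needs `lam ^ 2 ≤ n / 3` at non-initial types, which follows
  -- from `lam ≤ Λ`.
  have h8 : ∀ b, b ∉ 𝔹.I → 8 * (1 + Λ) ^ 2 ≤ A * n b := fun b hb => by
    refine le_trans ?_ (hwidth b hb)
    have h1 : 1 ≤ (R + η) ^ 2 / η ^ 2 := by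
      rw [one_le_div (by positivity)]
      exact pow_le_pow_left₀ hη.le (by linarith) 2
    have h2 : (1 + Λ) ^ 2 ≤ (1 + Λ) ^ (1 + Fintype.card VB) := by
      refine pow_le_pow_right₀ (by linarith) ?_
      have := Fintype.card_pos_iff.2 ⟨b⟩
      omega
    exact mul_le_mul (by linarith) h2 (by positivity) (by positivity)
  have hnpos : ∀ b, b ∉ 𝔹.I → 0 < n b := fun b hb => by
    refine Nat.pos_of_ne_zero fun h0 => ?_
    have h1 := h8 b hb
    rw [h0, Nat.cast_zero, mul_zero] at h1
    have : 0 < 8 * (1 + Λ) ^ 2 := by positivity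
    linarith
  have hhead : ∀ e : Edge B, e.1.2 ∉ 𝔹.I := fun e he => by
    have h1 : e.1.1 ∈ parents B e.1.2 := e.2
    rw [𝔹.parents_eq_empty _ he] at h1
    exact h1
  have hsmall : ∀ e : Edge B, lam e ≤ n e.1.1 / 2 ∧ lam e ^ 2 ≤ n e.1.1 / 3 := fun e => by
    have h0 := hlam e
    by_cases he : e.1.1 ∈ 𝔹.I
    · have h1 := le_min_iff.1 (hlam_input e he)
      have h2 : n e.1.1 = n0 ⟨e.1.1, he⟩ := hn ⟨e.1.1, he⟩
      rw [h2]
      exact ⟨h1.1, (Real.le_sqrt h0.le (by positivity)).1 h1.2⟩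
    · have h1 := h8 _ he
      obtain ⟨v⟩ := hV
      have h2 : A ≤ 1 := (hAα v).trans (hα01 v).2
      have h3 : A * n e.1.1 ≤ n e.1.1 := mul_le_of_le_one_left (Nat.cast_nonneg _) h2
      have h4 : lam e ≤ Λ := by
        have := hLΛ e
        rw [← hL] at this
        linarith
      constructor <;> nlinarith
  let D : (Σ e : Edge B, Fin (n e.1.1)) → Set Ω := fun p =>
    {ω | L p.1 * (n p.1.1.2 / n p.1.1.1) < ((Finset.univ.filter fun j : Fin (n p.1.1.2) =>
        m ⟨(⟨p.1.1.1, p.2⟩, ⟨p.1.1.2, j⟩), p.1.2⟩ ω = true).card : ℝ)}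
  let F : Gstar.V → Set Ω := fun v =>
    {ω | (∀ u, r (Gstar.π u) < r (Gstar.π v) → α u * n (Gstar.π u) ≤
        coverCard Gstar tag (fun e => config Gstar wstar tag (η / 2) m w0 e ω) u) ∧
      (coverCard Gstar tag (fun e => config Gstar wstar tag (η / 2) m w0 e ω) v : ℝ) <
        α v * n (Gstar.π v)}
  have hD : ∀ p, P.real (D p) ≤ ε / n p.1.1.1 := fun p => by
    refine (measureReal_outdegree_gt_le hlam hrandom p.1 (hn_growth p.1) (hnpos _ (hhead p.1))
      p.2 hl0 (hL p.1).le).trans ?_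
    gcongr
    rw [← Real.le_log_iff_exp_le hε0, hlogε]
    linarith
  have hF : ∀ v, P.real (F v) ≤ ε := fun v => by
    -- Comparing `exp (-(1 + Λ))` with `ε` requires a base edge to bound `Λ` below; without an edge
    -- into the type of `v`, the count is deterministic instead.
    by_cases hpar : parents B (Gstar.π v) = ∅
    · have h1 : F v = ∅ := Set.eq_empty_of_forall_notMem fun ω hω => by
        refine absurd hω.2 (not_lt.2 (alpha_mul_le_coverCard_of_parents_eq_empty hlam hN_prob
          hN_support hn htype hη2 _ (fun hI => by rw [hcard]; exact htagI v hI)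
          (fun hI => by rw [hcard]; exact htagN v hI) (fun hI => ?_) hpar))
        have h2 := h8 _ hI
        have h3 := mul_le_mul_of_nonneg_right (hAα v) (Nat.cast_nonneg (α := ℝ) (n (Gstar.π v)))
        have h4 : 1 ≤ (1 + Λ) ^ 2 := one_le_pow₀ (by linarith)
        linarith
      rw [h1, measureReal_empty]
      exact hε0.le
    · obtain ⟨a, ha⟩ := Set.nonempty_iff_ne_empty.2 hpar
      have hI : Gstar.π v ∉ 𝔹.I := hhead ⟨(a, Gstar.π v), ha⟩
      refine (measureReal_first_failure_config_le hlam hN_prob hN_support hrandom hsmall htype hη2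
        hI (by rw [hcard]; exact htagN v hI) hrank hΛ0 ?_).trans ?_
      · have h2 := h8 _ hI
        have h3 := mul_le_mul_of_nonneg_right (hAα v) (Nat.cast_nonneg (α := ℝ) (n (Gstar.π v)))
        change 8 * (1 + Λ) ≤ α v * n (Gstar.π v)
        nlinarith
      · rw [← Real.le_log_iff_exp_le hε0, hlogε]
        have h2 := hLΛ ⟨(a, Gstar.π v), ha⟩
        have h3 := hlam ⟨(a, Gstar.π v), ha⟩
        rw [← hL] at h2
        linarith
  have hsum : ∑ p, P.real (D p) + ∑ v, P.real (F v) ≤ δ := by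
    have h1 : ∑ p, P.real (D p) ≤ Fintype.card (Edge B) * ε := by
      refine (Finset.sum_le_sum fun p _ => hD p).trans ?_
      rw [Fintype.sum_sigma]
      have h2 : ∀ e : Edge B, ∑ _i : Fin (n e.1.1), ε / n e.1.1 ≤ ε := fun e => by
        rw [Finset.sum_const, Finset.card_univ, Fintype.card_fin, nsmul_eq_mul,
          mul_div_left_comm]
        exact mul_le_of_le_one_right hε0.le (div_self_le_one _)
      refine (Finset.sum_le_sum fun e _ => h2 e).trans (le_of_eq ?_)
      rw [Finset.sum_const, Finset.card_univ, nsmul_eq_mul]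
    have h2 : ∑ v, P.real (F v) ≤ Fintype.card Gstar.V * ε := by
      refine (Finset.sum_le_sum fun v _ => hF v).trans (le_of_eq ?_)
      rw [Finset.sum_const, Finset.card_univ, nsmul_eq_mul]
    have h3 : K * ε = δ := mul_div_cancel₀ δ (by linarith)
    rw [hK, add_mul] at h3
    linarith
  have key := one_sub_le_measureReal_of_forall (P := P) (D := D) (F := F)
    (S := {ω | ∀ w : Param (sparseLift hn fun e => m e ω),
        paramDist w (restrictParam hn (fun e => m e ω) fun e => w0 e ω) ≤ R →
          HasCover w wstar (fun x => 1 / 2 * α x) η}) fun ω => by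
    by_contra hcon
    push Not at hcon
    obtain ⟨h1, h2, h3⟩ := hcon
    refine h1 fun w hw => hasCover_of_coverCard hn Gstar wstar htype hinput m w0 ω hη hR hA hAα
      (fun v => ?_) L hL0 (fun e i => ?_) hwidth w hw
    -- If some count failed, a failure of minimal rank would lie in the corresponding `F v`.
    · induction hk : r (Gstar.π v) using Nat.strong_induction_on generalizing v with
      | _ k ih =>
      by_contra hlt
      exact h3 v ⟨fun u hu => ih _ (hk ▸ hu) u rfl, not_le.1 hlt⟩
    · refine le_trans (le_of_eq ?_) (le_of_not_gt fun hlt => h2 ⟨e, i⟩ hlt)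
      rw [← Set.ncard_coe_finset]
      congr 2
      ext j
      simp
  rw [← ofReal_measureReal]
  exact ENNReal.ofReal_le_ofReal (by linarith)
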